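/- Consider a wireless CDMA network with finite node set $\mathcal N$ and directed links $(i,j)$, $j\in\mathcal O(i)$, where $\mathcal O(i)\subseteq\mathcal N$ is the set of next-hop neighbours of $i$. Let $h_{mj}\ge 0$ be the channel gains ($h_{ij}>0$ on every link), $K>0$ the processing gain, $\theta_i\in[0,1]$ the self-interference parameters, $N_j>0$ the noise powers, $\hat P_i>1$ the peak powers, and $b^*_{ij}>0$ a weight for every link. For power allocation variables $\boldsymbol\eta_i=(\eta_{ij})_{j\in\mathcal O(i)}$ and power control variables $\boldsymbol\gamma=(\gamma_i)_{i\in\mathcal N}$ put $P_i=\hat P_i^{\gamma_i}$, $P_{ij}=P_i\eta_{ij}$ and $$IN_{ij}=\theta_i h_{ij}P_i(1-\eta_{ij})+\sum_{m\ne i}h_{mj}P_m+N_j .$$ The TOPC problem is to maximize $$\sum_{(i,j)} b^*_{ij}\log\frac{K h_{ij}P_{ij}}{IN_{ij}}\qquad(\log 0=-\infty)$$ subject to $\eta_{ij}\ge 0$ for every link $(i,j)$, and $\sum_{j\in\mathcal O(i)}\eta_{ij}=1$, $\gamma_i\le 1$ for every node $i$. The marginal gain indicators are $$\delta\eta_{ij}=b^*_{ij}\Big(\frac1{P_{ij}}+\frac{\theta_ih_{ij}}{IN_{ij}}\Big),\qquad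 \delta\gamma_i=P_i\Big[-\sum_{m\ne i}\sum_{k\in\mathcal O(m)}\frac{b^*_{mk}h_{ik}}{IN_{mk}}-\sum_{k\in\mathcal O(i)}\frac{\theta_ib^*_{ik}h_{ik}}{IN_{ik}}+\sum_{k\in\mathcal O(i)}\delta\eta_{ik}\,\eta_{ik}\Big].$$ For a matrix $Q$ let $[\tilde{\boldsymbol x}]^+_{Q}$ be the minimizer of $(\boldsymbol x-\tilde{\boldsymbol x})'Q(\boldsymbol x-\tilde{\boldsymbol x})$ over the feasible $\boldsymbol x$ (probability vectors on $\mathcal O(i)$ for $\boldsymbol\eta_i$; vectors with all $\gamma_i\le1$ for $\boldsymbol\gamma$). The algorithms are $$PA:\ \boldsymbol\eta_i^{k+1}=\big[\boldsymbol\eta_i^k+\beta_i^k(Q_i^k)^{-1}\delta\boldsymbol\eta_i^k\big]^+_{Q_i^k},\qquad PC:\ \boldsymbol\gamma^{k+1}=\big[\boldsymbol\gamma^k+\xi^k(V^k)^{-1}\delta\boldsymbol\gamma^k\big]^+_{V^k},$$ where the scaling matrices $Q_i^k$ are symmetric, invertible and positive definite on $\{\boldsymbol v:\sum_j v_j=0\}$,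 the $V^k$ are symmetric positive definite, and all these matrices are diagonal, so that each node can run both algorithms on its own variables. In iteration $k$ an arbitrary set of nodes runs $PA$ and an arbitrary set of nodes runs $PC$, all using the values $(\boldsymbol\eta^k,\boldsymbol\gamma^k)$, and the remaining variables are kept; the only requirement on this schedule is that each node runs each of the two algorithms infinitely often (for example, in every iteration). Theorem. From any feasible initial configuration $\{\boldsymbol\eta_i^0\}$, $\boldsymbol\gamma^0$ with all $\eta^0_{ij}>0$, and for any such schedule, there exist scaling matrices $Q_i^k$, $V^k$ as above and positive stepsizes $\beta_i^k$, $\xi^k$ such that the iterates of $PA$ and $PC$ keep all $\eta_{ij}^k>0$ and converge, $\boldsymbol\eta_i^k\to\boldsymbol\eta_i^*$ for all $i$ and $\boldsymbol\gamma^k\to\boldsymbol\gamma^*$ as $k\to\infty$, and $\{\boldsymbol\eta_i^*\},\boldsymbol\gamma^*$ jointly solve the TOPC problem. -/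

import Mathlib

open Filter Topology
open scoped Matrix

/-- A CDMA wireless network with finite node set `N` at a fixed time slot.  The directed links are
the pairs `(i, j)` with `j ∈ out i`; `out i` is the set `𝒪(i)` of next-hop neighbours of `i`. -/
structure CDMANetwork (N : Type*) where
  /-- next-hop neighbours of each node -/
  out : N → Finset N
  /-- channel gain from `i` to `j`, also for pairs that are not links (it may then vanish) -/
  gain : N → N → ℝ
  gain_nonneg : ∀ i j, 0 ≤ gain i j
  gain_pos : ∀ i, ∀ j ∈ out i, 0 < gain i j
  /-- processing gain `K` -/
  K : ℝ
  K_pos : 0 < K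
  /-- self-interference parameters -/
  θ : N → ℝ
  θ_nonneg : ∀ i, 0 ≤ θ i
  θ_le_one : ∀ i, θ i ≤ 1
  /-- receiver noise powers -/
  noise : N → ℝ
  noise_pos : ∀ j, 0 < noise j
  /-- peak powers, normalized so that their logarithms are positive -/
  peak : N → ℝ
  one_lt_peak : ∀ i, 1 < peak i
  /-- maximum differential backlogs `b*` of the links -/
  b : N → N → ℝ
  b_pos : ∀ i, ∀ j ∈ out i, 0 < b i j

namespace CDMANetwork

variable {N : Type*}

/-- Power allocation variables `η = (η_{ij})_{(i,j) link}`. -/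
abbrev Alloc (net : CDMANetwork N) : Type _ := (i : N) → net.out i → ℝ

/-- Total transmission power of node `i`, `P_i = (peak_i)^{γ_i}`. -/
noncomputable def nodePower (net : CDMANetwork N) (γ : N → ℝ) (i : N) : ℝ :=
  net.peak i ^ γ i

/-- Power on the link `(i, j)`, `P_{ij} = P_i η_{ij}`. -/
noncomputable def linkPower (net : CDMANetwork N) (η : net.Alloc) (γ : N → ℝ) (i : N)
    (j : net.out i) : ℝ :=
  net.nodePower γ i * η i j

/-- The feasible power allocations `{η_i}`: each `η_i` is a probability vector on `𝒪(i)`. -/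
def FeasibleAlloc (net : CDMANetwork N) (η : net.Alloc) : Prop :=
  ∀ i, η i ∈ stdSimplex ℝ (net.out i)

/-- The feasible set of the power control vector: `γ_i ≤ 1` for every node. -/
def controlSet (N : Type*) : Set (N → ℝ) := {γ | ∀ i, γ i ≤ 1}

variable [Fintype N] [DecidableEq N]

/-- Interference plus noise `IN_{ij}` at the receiver of the link `(i, j)`. -/
noncomputable def IN (net : CDMANetwork N) (η : net.Alloc) (γ : N → ℝ) (i : N)
    (j : net.out i) : ℝ :=
  net.θ i * net.gain i j * net.nodePower γ i * (1 - η i j)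
    + ∑ m ∈ Finset.univ.erase i, net.gain m j * net.nodePower γ m + net.noise j

/-- Signal-to-interference-plus-noise ratio of the link `(i, j)`. -/
noncomputable def SINR (net : CDMANetwork N) (η : net.Alloc) (γ : N → ℝ) (i : N)
    (j : net.out i) : ℝ :=
  net.K * net.gain i j * net.linkPower η γ i j / net.IN η γ i j

/-- The objective `∑ b*_{ij} log SINR_{ij}`, with values in `[-∞, ∞]` so that `log 0 = -∞`. -/
noncomputable def objective (net : CDMANetwork N) (η : net.Alloc) (γ : N → ℝ) : EReal :=
  ∑ i, ∑ j : net.out i, (net.b i j : EReal) * ENNReal.log (ENNReal.ofReal (net.SINR η γ i j))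

/-- `(η, γ)` solves the Throughput Optimal Power Control problem. -/
def SolvesTOPC (net : CDMANetwork N) (η : net.Alloc) (γ : N → ℝ) : Prop :=
  net.FeasibleAlloc η ∧ γ ∈ controlSet N ∧
    ∀ (η' : net.Alloc) (γ' : N → ℝ), net.FeasibleAlloc η' → γ' ∈ controlSet N →
      net.objective η' γ' ≤ net.objective η γ

/-- Power allocation marginal gain indicators `δη_i = (δη_{ij})_{j ∈ 𝒪(i)}`.
Meaningful where all `η_{ij}` are positive. -/
noncomputable def dEta (net : CDMANetwork N) (η : net.Alloc) (γ : N → ℝ) (i : N) :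
    net.out i → ℝ := fun j =>
  net.b i j * (1 / net.linkPower η γ i j + net.θ i * net.gain i j / net.IN η γ i j)

/-- Power control marginal gain indicators `δγ = (δγ_i)_i`. -/
noncomputable def dGamma (net : CDMANetwork N) (η : net.Alloc) (γ : N → ℝ) : N → ℝ := fun i =>
  net.nodePower γ i *
    ((∑ m ∈ Finset.univ.erase i, ∑ k : net.out m,
        -(net.b m k * net.gain i k) / net.IN η γ m k)
      + (∑ k : net.out i, -(net.θ i * net.b i k * net.gain i k) / net.IN η γ i k)
      + ∑ k : net.out i, net.dEta η γ i k * η i k)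

end CDMANetwork

/-- `y` is the projection of `z` on `F` relative to the norm induced by `Q`: it minimizes
`(x - z)' Q (x - z)` over `x ∈ F`. -/
def IsScaledProjection {ι : Type*} [Fintype ι] (Q : Matrix ι ι ℝ) (F : Set (ι → ℝ))
    (z y : ι → ℝ) : Prop :=
  y ∈ F ∧ ∀ x ∈ F, (y - z) ⬝ᵥ (Q *ᵥ (y - z)) ≤ (x - z) ⬝ᵥ (Q *ᵥ (x - z))

/-- Scaling matrices admitted for the power allocation algorithm: symmetric, positive definite on
the subspace `∑ v_j = 0`, invertible (the algorithm uses the inverse), and diagonal. -/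
def ValidAllocScaling {ι : Type*} [Fintype ι] [DecidableEq ι] (Q : Matrix ι ι ℝ) : Prop :=
  Q.IsSymm ∧ (∀ v : ι → ℝ, v ≠ 0 → ∑ j, v j = 0 → 0 < v ⬝ᵥ (Q *ᵥ v)) ∧ IsUnit Q.det ∧ Q.IsDiag

/-- Scaling matrices admitted for the power control algorithm: symmetric positive definite, and
diagonal (so that the algorithm can be run by the nodes individually). -/
def ValidControlScaling {ι : Type*} (V : Matrix ι ι ℝ) : Prop :=
  V.PosDef ∧ V.IsDiag

namespace CDMANetwork

variable {N : Type*} [Fintype N] [DecidableEq N]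

/-- `v` is the outcome `PA(η_i)` of one step of the power allocation algorithm at node `i`. -/
def IsPA (net : CDMANetwork N) (η : net.Alloc) (γ : N → ℝ) (i : N)
    (Q : Matrix (net.out i) (net.out i) ℝ) (β : ℝ) (v : net.out i → ℝ) : Prop :=
  IsScaledProjection Q (stdSimplex ℝ (net.out i)) (η i + β • (Q⁻¹ *ᵥ net.dEta η γ i)) v

/-- `g` is the outcome `PC(γ)` of one step of the (network-wide) power control algorithm. -/
def IsPC (net : CDMANetwork N) (η : net.Alloc) (γ : N → ℝ)
    (V : Matrix N N ℝ) (ξ : ℝ) (g : N → ℝ) : Prop :=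
  IsScaledProjection V (controlSet N) (γ + ξ • (V⁻¹ *ᵥ net.dGamma η γ)) g

/-- The sequences `η^k`, `γ^k` are generated by the algorithms `PA` and `PC` with scaling matrices
`Q`, `V` and stepsizes `β`, `ξ`, where in iteration `k` the nodes in `runPA k` run `PA`, the nodes
in `runPC k` run `PC`, and all other variables are kept.  (For diagonal `V` the components of
`PC(γ)` do not influence each other, so that every node can run `PC` on its own variable.)
The first field says that the marginal gain indicators are defined at every iterate. -/
structure Generated (net : CDMANetwork N) (runPA runPC : ℕ → Set N)
    (Q : ℕ → (i : N) → Matrix (net.out i) (net.out i) ℝ) (β : ℕ → N → ℝ)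
    (V : ℕ → Matrix N N ℝ) (ξ : ℕ → ℝ) (η : ℕ → net.Alloc) (γ : ℕ → N → ℝ) : Prop where
  pos : ∀ k i j, 0 < η k i j
  pa_run : ∀ k, ∀ i ∈ runPA k, net.IsPA (η k) (γ k) i (Q k i) (β k i) (η (k + 1) i)
  pa_keep : ∀ k, ∀ i ∉ runPA k, η (k + 1) i = η k i
  pc : ∀ k, ∃ g, net.IsPC (η k) (γ k) (V k) (ξ k) g ∧
    (∀ i ∈ runPC k, γ (k + 1) i = g i) ∧ ∀ i ∉ runPC k, γ (k + 1) i = γ k i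

end CDMANetwork

/-! In the coordinates log P_i, log η_ij the objective is concave: since the η_ij of a node sum to
one, 1 - η_mk is the sum of the other shares, so every IN_mk is a posynomial with a positive
constant term. This yields a global first-order bound (`utility_sub_le`). The simplex constraint is
not convex in these coordinates, but at a stationary point the allocation part of the bound is a
positive multiple of a negative Kullback-Leibler divergence. Hence Gibbs' inequality gives
optimality and uniqueness of the allocation (`Stationary.utility_le_and_alloc_eq`). The power vector
is unique by comparing two optima at the node of largest power ratio (`Stationary.control_le`).

Convergence is a purely topological statement about ascent by blocks (`exists_stepsizes_tendsto`).
The stepsizes are free, so they can follow a plan. An anchor point fixes a single-block step with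
gain more than half the best possible. While the planned block is not scheduled, all stepsizes are
so small that the plan stays valid. When it is scheduled, the planned step is made, the other
scheduled blocks being perturbed only slightly, and the new point becomes the anchor. The anchor
values increase to a limit, so the planned gains tend to zero and a cluster point of the anchors
admits no improving single-block step. Compact superlevel sets and uniqueness of the maximizer then
force the whole sequence to converge.

Each node contributes two blocks, its allocation and its power. With identity allocation scaling,
and as long as the result stays positive, the projection on the simplex only subtracts the mean from
the step. A diagonal V carries an individual stepsize for every node, and its projection truncates
at 1. An interior configuration with no improving single-block step is stationary, by the
first-order bound applied at nearby points. -/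

/-! ### Block ascent under an arbitrary schedule. -/

namespace BlockAscent

variable {X B : Type*}

/-- The stepsizes actually in force when only the blocks in `R` are run. -/
noncomputable def mask (R : Set B) (p : B → ℝ) : B → ℝ := R.indicator p

/-- No step in a single block stays in the domain and improves the objective. -/
def Stuck [DecidableEq B] (D : Set X) (F : X → ℝ) (T : X → (B → ℝ) → X) (x : X) : Prop :=
  ∀ b σ, 0 < σ → T x (Pi.single b σ) ∈ D → F (T x (Pi.single b σ)) ≤ F x

/-- From a point that is not stuck there is a single-block step whose gain is more than half the
best possible one. -/
theorem exists_nearly_best_step [DecidableEq B] {D : Set X} {F : X → ℝ} {T : X → (B → ℝ) → X}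
    (hbdd : BddAbove (F '' D)) {x : X} (hx : ¬ Stuck D F T x) :
    ∃ (b : B) (σ g : ℝ), 0 < σ ∧ 0 < g ∧ T x (Pi.single b σ) ∈ D ∧
      F x + g < F (T x (Pi.single b σ)) ∧
      ∀ b' σ', 0 < σ' → T x (Pi.single b' σ') ∈ D →
        F (T x (Pi.single b' σ')) ≤ F x + 2 * g := by
  unfold Stuck at hx
  push Not at hx
  obtain ⟨b₀, σ₀, hσ₀, hD₀, hF₀⟩ := hx
  obtain ⟨M, hM⟩ := hbdd
  set S : Set ℝ := {r | ∃ b σ, 0 < σ ∧ T x (Pi.single b σ) ∈ D ∧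
    r = F (T x (Pi.single b σ)) - F x} with hS
  have hSb : BddAbove S := by
    refine ⟨M - F x, ?_⟩
    rintro r ⟨b, σ, -, hD, rfl⟩
    have := hM ⟨_, hD, rfl⟩
    linarith
  have hmem : F (T x (Pi.single b₀ σ₀)) - F x ∈ S := ⟨b₀, σ₀, hσ₀, hD₀, rfl⟩
  have hpos : 0 < sSup S := lt_of_lt_of_le (by linarith) (le_csSup hSb hmem)
  obtain ⟨r, ⟨b, σ, hσ, hD, rfl⟩, hr⟩ :=
    exists_lt_of_lt_csSup ⟨_, hmem⟩ (half_lt_self hpos)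
  refine ⟨b, σ, sSup S / 2, hσ, by linarith, hD, by linarith, fun b' σ' hσ' hD' => ?_⟩
  have := le_csSup hSb ⟨b', σ', hσ', hD', rfl⟩
  linarith

/-- Any property of the stepsizes that holds near a nonnegative vector holds for a positive one. -/
theorem exists_pos_of_eventually [Finite B] {p₀ : B → ℝ} (h₀ : ∀ b, 0 ≤ p₀ b)
    {q : (B → ℝ) → Prop} (hq : ∀ᶠ p in 𝓝 p₀, q p) : ∃ p, (∀ b, 0 < p b) ∧ q p := by
  have ht : Tendsto (fun ε : ℝ => fun b => p₀ b + ε) (𝓝[>] 0) (𝓝 p₀) := by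
    have : Continuous (fun ε : ℝ => fun b => p₀ b + ε) := by fun_prop
    have h := this.tendsto 0
    simp only [add_zero] at h
    exact h.mono_left nhdsWithin_le_nhds
  obtain ⟨ε, hε, hpos⟩ := ((ht.eventually hq).and self_mem_nhdsWithin).exists
  exact ⟨_, fun b => add_pos_of_nonneg_of_pos (h₀ b) hpos, hε⟩

theorem continuous_mask (R : Set B) : Continuous (mask R) := by
  classical
  refine continuous_pi fun b => ?_
  by_cases hb : b ∈ R
  · simpa [mask, hb] using continuous_apply b
  · simpa [mask, hb] using continuous_const

/-- Convergence of block ascent under an arbitrary schedule.  `T x p` is the result of one step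
from `x` with stepsizes `p`; if every block is run infinitely often then positive stepsizes can be
chosen such that the iterates converge to a point which no single-block step improves. -/
theorem exists_stepsizes_tendsto [TopologicalSpace X] [Finite B] [DecidableEq B]
    {D : Set X} {F : X → ℝ} {T : X → (B → ℝ) → X} {run : ℕ → Set B}
    (hrun : ∀ b, ∃ᶠ k in atTop, b ∈ run k)
    (hF : ∀ x ∈ D, ContinuousAt F x)
    (hT : ∀ x ∈ D, ∀ p, ContinuousAt (fun q : X × (B → ℝ) => T q.1 q.2) (x, p))
    (hT0 : ∀ x ∈ D, T x 0 = x)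
    (hTD : ∀ x ∈ D, ∀ p, T x p ∈ D →
      ∀ᶠ q : X × (B → ℝ) in 𝓝 (x, p), q.1 ∈ D → T q.1 q.2 ∈ D)
    (hcomp : ∀ c, ∃ K ⊆ D, IsCompact K ∧ ∀ x ∈ D, c ≤ F x → x ∈ K)
    (hbdd : BddAbove (F '' D))
    (hstat : ∀ x ∈ D, Stuck D F T x → ∀ p, (∀ b, 0 ≤ p b) → T x p = x)
    (huniq : ∀ x ∈ D, ∀ y ∈ D, Stuck D F T x → F x ≤ F y → y = x)
    {x₀ : X} (hx₀ : x₀ ∈ D) :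
    ∃ (p : ℕ → B → ℝ) (x : ℕ → X), (∀ k b, 0 < p k b) ∧ x 0 = x₀ ∧ (∀ k, x k ∈ D) ∧
      (∀ k, x (k + 1) = T (x k) (mask (run k) (p k))) ∧
      ∃ xs ∈ D, Stuck D F T xs ∧ Tendsto x atTop (𝓝 xs) := by
  have hplan : ∀ y : {y // ¬ Stuck D F T y}, _ := fun y =>
    exists_nearly_best_step hbdd y.2
  choose b σ g hσ hg hTy hgain hbest using hplan
  -- `Good x y`: the current point `x` is close enough to the anchor `y`
  let Good : X → X → Prop := fun x y => x ∈ D ∧ y ∈ D ∧ (Stuck D F T y → x = y) ∧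
    ∀ h : ¬ Stuck D F T y, F y - g ⟨y, h⟩ < F x ∧ T x (Pi.single (b ⟨y, h⟩) (σ ⟨y, h⟩)) ∈ D ∧
      F y + g ⟨y, h⟩ < F (T x (Pi.single (b ⟨y, h⟩) (σ ⟨y, h⟩)))
  have good_self : ∀ y ∈ D, Good y y := fun y hy =>
    ⟨hy, hy, fun _ => rfl, fun h => ⟨by linarith [hg ⟨y, h⟩], hTy ⟨y, h⟩, hgain ⟨y, h⟩⟩⟩
  -- continuity of a step in the stepsizes
  have hTp : ∀ x ∈ D, ∀ R : Set B, ∀ p, Tendsto (fun q => T x (mask R q)) (𝓝 p)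
      (𝓝 (T x (mask R p))) := by
    intro x hx R p
    have h1 : Tendsto (fun q => (x, mask R q)) (𝓝 p) (𝓝 (x, mask R p)) :=
      tendsto_const_nhds.prodMk_nhds ((continuous_mask R).tendsto p)
    exact (hT x hx (mask R p)).tendsto.comp h1
  have hTpD : ∀ x ∈ D, ∀ R : Set B, ∀ p, T x (mask R p) ∈ D →
      ∀ᶠ q in 𝓝 p, T x (mask R q) ∈ D := by
    intro x hx R p hp
    have h1 : Tendsto (fun q => (x, mask R q)) (𝓝 p) (𝓝 (x, mask R p)) :=
      tendsto_const_nhds.prodMk_nhds ((continuous_mask R).tendsto p)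
    filter_upwards [h1.eventually (hTD x hx _ hp)] with q hq using hq hx
  -- The conditions on the current point are strict inequalities and membership of a relatively open
  -- kind, so small moves within `D` preserve them.
  have good_near : ∀ y x, Good x y → ∀ h : ¬ Stuck D F T y,
      ∀ᶠ z in 𝓝 x, z ∈ D → Good z y := by
    intro y x hxy h
    obtain ⟨hxD, hyD, -, hgood⟩ := hxy
    obtain ⟨h1, h2, h3⟩ := hgood h
    set e : B → ℝ := Pi.single (b ⟨y, h⟩) (σ ⟨y, h⟩)
    have hc : Tendsto (fun z => (z, e)) (𝓝 x) (𝓝 (x, e)) :=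
      tendsto_id.prodMk_nhds tendsto_const_nhds
    have e1 := (hF x hxD).tendsto.eventually (lt_mem_nhds h1)
    have e2 := hc.eventually (hTD x hxD _ h2)
    have e3 := ((hF _ h2).tendsto.comp ((hT x hxD e).tendsto.comp hc)).eventually
      (lt_mem_nhds h3)
    filter_upwards [e1, e2, e3] with z z1 z2 z3 hz
    exact ⟨hz, hyD, fun h' => absurd h' h, fun _ => ⟨z1, z2 hz, z3⟩⟩
  -- The state of the recursion is a pair (current point, anchor). The anchor changes exactly when
  -- its planned block is run, and its value then rises by more than the planned gain.
  have step : ∀ k : ℕ, ∀ s : {s : X × X // Good s.1 s.2}, ∃ (p : B → ℝ)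
      (s' : {s : X × X // Good s.1 s.2}), (∀ b, 0 < p b) ∧
      s'.1.1 = T s.1.1 (mask (run k) p) ∧ F s.1.2 ≤ F s'.1.2 ∧
      (Stuck D F T s.1.2 → s'.1.2 = s.1.2) ∧
      ∀ h : ¬ Stuck D F T s.1.2,
        (b ⟨s.1.2, h⟩ ∈ run k → F s.1.2 + g ⟨s.1.2, h⟩ < F s'.1.2) ∧
        (b ⟨s.1.2, h⟩ ∉ run k → s'.1.2 = s.1.2) := by
    rintro k ⟨⟨x, y⟩, hxy⟩
    have hGood : Good x y := hxy
    obtain ⟨hxD, hyD, hst, hns⟩ := hxy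
    dsimp only at hxD hyD hst hns ⊢
    by_cases h : Stuck D F T y
    · obtain rfl := hst h
      -- A stuck point is fixed under all nonnegative stepsizes, so the value 1 is arbitrary.
      refine ⟨fun _ => 1, ⟨(x, x), good_self x hxD⟩, fun _ => one_pos, ?_, le_rfl,
        fun _ => rfl, fun h' => absurd h h'⟩
      refine (hstat x hxD h _ fun b => ?_).symm
      exact Set.indicator_nonneg (fun _ _ => zero_le_one) b
    obtain ⟨h1, h2, h3⟩ := hns h
    by_cases hb : b ⟨y, h⟩ ∈ run k
    · have hm : mask (run k) (Pi.single (b ⟨y, h⟩) (σ ⟨y, h⟩)) =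
          Pi.single (b ⟨y, h⟩) (σ ⟨y, h⟩) := by
        funext c
        by_cases hc : c ∈ run k
        · simp [mask, hc]
        · have : c ≠ b ⟨y, h⟩ := fun hcb => hc (hcb ▸ hb)
          simp [mask, hc, this]
      have e1 := hTpD x hxD (run k) (Pi.single (b ⟨y, h⟩) (σ ⟨y, h⟩)) (by rwa [hm])
      have e2 := hTp x hxD (run k) (Pi.single (b ⟨y, h⟩) (σ ⟨y, h⟩))
      rw [hm] at e2
      have e3 := ((hF _ h2).tendsto.comp e2).eventually (lt_mem_nhds h3)
      have h0 : (0 : B → ℝ) ≤ Pi.single (b ⟨y, h⟩) (σ ⟨y, h⟩) :=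
        Pi.single_nonneg.2 (hσ ⟨y, h⟩).le
      -- The planned step has stepsize zero in all other blocks; a slight increase makes every
      -- stepsize positive without losing the gain.
      obtain ⟨p, hp, hpD, hpF⟩ := exists_pos_of_eventually (fun c => h0 c) (e1.and e3)
      refine ⟨p, ⟨(_, _), good_self _ hpD⟩, hp, rfl, ?_, fun h' => absurd h' h,
        fun _ => ⟨fun _ => hpF, fun hb' => absurd hb hb'⟩⟩
      have := hg ⟨y, h⟩
      simp only [Function.comp_apply] at hpF
      dsimp only
      linarith
    · have hm : mask (run k) (0 : B → ℝ) = 0 := Set.indicator_zero _ _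
      have e1 := hTpD x hxD (run k) 0 (by rwa [hm, hT0 x hxD])
      have e2 := hTp x hxD (run k) 0
      rw [hm, hT0 x hxD] at e2
      obtain ⟨p, hp, hpD, hpG⟩ := exists_pos_of_eventually (fun _ => le_rfl)
        (e1.and (e2.eventually (good_near y x hGood h)))
      exact ⟨p, ⟨(_, y), hpG hpD⟩, hp, rfl, le_rfl, fun _ => rfl,
        fun _ => ⟨fun hb' => absurd hb' hb, fun _ => rfl⟩⟩
  choose p nxt hp hnext hmono hstuck hmove using step
  let s : ℕ → {s : X × X // Good s.1 s.2} := fun k =>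
    Nat.rec ⟨(x₀, x₀), good_self x₀ hx₀⟩ (fun k s => nxt k s) k
  let x : ℕ → X := fun k => (s k).1.1
  let y : ℕ → X := fun k => (s k).1.2
  have hG : ∀ k, Good (x k) (y k) := fun k => (s k).2
  have hyD : ∀ k, y k ∈ D := fun k => (hG k).2.1
  have hxD : ∀ k, x k ∈ D := fun k => (hG k).1
  refine ⟨fun k => p k (s k), x, fun k => hp k (s k), rfl, hxD, fun k => hnext k (s k), ?_⟩
  by_cases hk : ∃ k, Stuck D F T (y k)
  · obtain ⟨k₀, hk₀⟩ := hk
    have hconst : ∀ n, y (k₀ + n) = y k₀ := by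
      intro n
      induction n with
      | zero => rfl
      | succ n ih =>
        have := hstuck (k₀ + n) (s (k₀ + n))
          (by rw [show (s (k₀ + n)).1.2 = y k₀ from ih]; exact hk₀)
        exact this.trans ih
    refine ⟨y k₀, hyD k₀, hk₀, tendsto_const_nhds.congr' ?_⟩
    filter_upwards [eventually_ge_atTop k₀] with k hk
    obtain ⟨n, rfl⟩ := Nat.exists_eq_add_of_le hk
    rw [(hG (k₀ + n)).2.2.1 (by rw [hconst n]; exact hk₀), hconst n]
  push Not at hk
  have hFmono : Monotone fun k => F (y k) := monotone_nat_of_le_succ fun k => hmono k (s k)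
  have hFb : BddAbove (Set.range fun k => F (y k)) :=
    hbdd.mono (by rintro _ ⟨k, rfl⟩; exact ⟨_, hyD k, rfl⟩)
  obtain ⟨L, hL⟩ : ∃ L, Tendsto (fun k => F (y k)) atTop (𝓝 L) :=
    ⟨_, tendsto_atTop_ciSup hFmono hFb⟩
  have hle : ∀ k, F (y k) ≤ L := fun k => hFmono.ge_of_tendsto hL k
  -- the planned gain is eventually realised
  have hgL : ∀ k, F (y k) + g ⟨y k, hk k⟩ ≤ L := by
    intro k
    have hex : ∃ n, b ⟨y k, hk k⟩ ∈ run (k + n) := by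
      obtain ⟨m, hm, hm'⟩ := (frequently_atTop.1 (hrun (b ⟨y k, hk k⟩))) k
      exact ⟨m - k, by rwa [Nat.add_sub_cancel' hm]⟩
    classical
    -- The anchor waits until the first iteration that runs its planned block.
    have hy : ∀ n ≤ Nat.find hex, y (k + n) = y k := by
      intro n
      induction n with
      | zero => exact fun _ => rfl
      | succ n ih =>
        intro hn
        have ihn : (s (k + n)).1.2 = y k := ih (by omega)
        have := (hmove (k + n) (s (k + n)) (hk _)).2
        refine (this ?_).trans ihn
        have h1 := Nat.find_min hex (show n < Nat.find hex by omega)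
        simp only [ihn]
        exact h1
    have h1 := (hmove (k + Nat.find hex) (s (k + Nat.find hex)) (hk _)).1
    have h2 : (s (k + Nat.find hex)).1.2 = y k := hy _ le_rfl
    simp only [h2] at h1
    exact (h1 (Nat.find_spec hex)).le.trans (hle (k + Nat.find hex + 1))
  obtain ⟨K, hKD, hK, hKmem⟩ := hcomp (F x₀)
  have hyK : ∀ k, y k ∈ K := fun k => hKmem _ (hyD k) (hFmono (Nat.zero_le k))
  obtain ⟨ys, hysK, hys⟩ := hK.exists_mapClusterPt_of_frequently (l := atTop) (f := y)
    (Eventually.frequently (Eventually.of_forall hyK))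
  have hysD := hKD hysK
  have hFys : F ys = L := by
    by_contra hne
    have : MapClusterPt (F ys) atTop (F ∘ y) := hys.continuousAt_comp (hF ys hysD)
    obtain ⟨U, V, hU, hV, hUV⟩ := t2_separation_nhds hne
    obtain ⟨k, hk1, hk2⟩ := ((mapClusterPt_iff_frequently.1 this U hU).and_eventually
      (hL.eventually hV)).exists
    exact Set.disjoint_left.1 hUV hk1 hk2
  -- An improving step at `ys` would, by continuity, take anchors near `ys` above L + 2ε. No
  -- single-block step from an anchor exceeds F(y) + 2g ≤ 2L - F(y), which tends to L.
  have hysS : Stuck D F T ys := by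
    intro c τ hτ hD
    by_contra! hlt
    obtain ⟨ε, hε, hε'⟩ : ∃ ε > 0, F ys + 2 * ε < F (T ys (Pi.single c τ)) :=
      ⟨(F (T ys (Pi.single c τ)) - F ys) / 3, by linarith, by linarith⟩
    have hc : Tendsto (fun z => (z, (Pi.single c τ : B → ℝ))) (𝓝 ys) (𝓝 (ys, Pi.single c τ)) :=
      tendsto_id.prodMk_nhds tendsto_const_nhds
    have e1 := hc.eventually (hTD ys hysD _ hD)
    have e2 := ((hF _ hD).tendsto.comp ((hT ys hysD _).tendsto.comp hc)).eventually
      (lt_mem_nhds hε')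
    have e3 := hL.eventually (lt_mem_nhds (show L - ε < L by linarith))
    obtain ⟨k, ⟨hk1, hk2⟩, hk3⟩ :=
      ((mapClusterPt_iff_frequently.1 hys _ (e1.and e2)).and_eventually e3).exists
    have h1 := hbest ⟨y k, hk k⟩ c τ hτ (hk1 (hyD k))
    have h2 := hgL k
    simp only [Function.comp_apply] at hk2 h1
    have h3 := hle k
    linarith
  refine ⟨ys, hysD, hysS, ?_⟩
  -- The current point loses less than g against its anchor, and g ≤ L - F(y). So the values at the
  -- current points also tend to L.
  have hxF : ∀ k, 2 * F (y k) - L ≤ F (x k) := by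
    intro k
    have h1 := ((hG k).2.2.2 (hk k)).1
    have h2 := hgL k
    linarith
  obtain ⟨K', hKD', hK', hKmem'⟩ := hcomp (2 * F x₀ - L)
  refine hK'.tendsto_nhds_of_unique_mapClusterPt
    (Eventually.of_forall fun k => hKmem' _ (hxD k) ?_) fun z hz hzc => ?_
  · have : F x₀ ≤ F (y k) := hFmono (Nat.zero_le k)
    linarith [hxF k]
  · refine huniq ys hysD z (hKD' hz) hysS ?_
    rw [hFys]
    by_contra! hlt
    have e1 := (hF z (hKD' hz)).tendsto.eventually
      (gt_mem_nhds (show F z < (F z + L) / 2 by linarith))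
    -- The threshold is chosen so that 2F(y) - L exceeds (L + F(z)) / 2, the bound on F(x) near z.
    have e2 := hL.eventually (lt_mem_nhds (show (3 * L + F z) / 4 < L by linarith))
    obtain ⟨k, hk1, hk2⟩ := ((mapClusterPt_iff_frequently.1 hzc _ e1).and_eventually e2).exists
    have := hxF k
    change F (x k) < (F z + L) / 2 at hk1
    linarith

end BlockAscent

/-! ### Two convexity inequalities. -/

/-- Jensen's inequality for the logarithm of a posynomial with a constant term. -/
theorem sum_mul_div_le_log_sub_log {ι : Type*} (s : Finset ι) (a e : ι → ℝ) {ν : ℝ}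
    (ha : ∀ t ∈ s, 0 ≤ a t) (hν : 0 < ν) :
    (∑ t ∈ s, a t * e t) / (∑ t ∈ s, a t + ν) ≤
      Real.log (∑ t ∈ s, a t * Real.exp (e t) + ν) - Real.log (∑ t ∈ s, a t + ν) := by
  have hA : 0 < ∑ t ∈ s, a t + ν := add_pos_of_nonneg_of_pos (Finset.sum_nonneg ha) hν
  have hA' : 0 < ∑ t ∈ s, a t * Real.exp (e t) + ν := add_pos_of_nonneg_of_pos
    (Finset.sum_nonneg fun t ht => mul_nonneg (ha t ht) (Real.exp_pos _).le) hν
  rw [← Real.log_div hA'.ne' hA.ne']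
  set A := ∑ t ∈ s, a t + ν with hAdef
  set A' := ∑ t ∈ s, a t * Real.exp (e t) + ν with hAdef'
  set r := Real.log (A' / A) with hr
  have hexp : Real.exp r = A' / A := Real.exp_log (div_pos hA' hA)
  -- The tangent of exp at r = log (A'/A). After summation the identity e^r A = A' cancels the
  -- constant terms and isolates r; the noise ν enters with exponent 0.
  have key : ∀ u : ℝ, Real.exp r * (1 + u - r) ≤ Real.exp u := fun u => by
    have h := Real.add_one_le_exp (u - r)
    calc Real.exp r * (1 + u - r) ≤ Real.exp r * Real.exp (u - r) :=
          mul_le_mul_of_nonneg_left (by linarith) (Real.exp_pos r).le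
      _ = Real.exp u := by rw [← Real.exp_add]; congr 1; ring
  have h1 : ∑ t ∈ s, a t * (Real.exp r * (1 + e t - r)) ≤ ∑ t ∈ s, a t * Real.exp (e t) :=
    Finset.sum_le_sum fun t ht => mul_le_mul_of_nonneg_left (key _) (ha t ht)
  have h2 : ν * (Real.exp r * (1 + 0 - r)) ≤ ν * 1 := by
    have := key 0
    rw [Real.exp_zero] at this
    exact mul_le_mul_of_nonneg_left this hν.le
  have h3 : ∑ t ∈ s, a t * (Real.exp r * (1 + e t - r)) =
      Real.exp r * (∑ t ∈ s, a t + ∑ t ∈ s, a t * e t - r * ∑ t ∈ s, a t) := by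
    rw [Finset.mul_sum, ← Finset.sum_add_distrib, ← Finset.sum_sub_distrib, Finset.mul_sum]
    exact Finset.sum_congr rfl fun t _ => by ring
  have h4 : Real.exp r * (A + ∑ t ∈ s, a t * e t - r * A) ≤ Real.exp r * A := by
    have : Real.exp r * A = A' := by rw [hexp]; field_simp
    rw [this, hAdef', hAdef]
    linarith
  have h5 := le_of_mul_le_mul_left h4 (Real.exp_pos r)
  rw [div_le_iff₀ hA]
  linarith

/-- Gibbs' inequality, with its equality case. -/
theorem sum_mul_log_sub_log_nonpos {ι : Type*} [Fintype ι] {p q : ι → ℝ}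
    (hp : ∀ j, 0 < p j) (hq : ∀ j, 0 < q j) (hsum : ∑ j, q j = ∑ j, p j) :
    ∑ j, p j * (Real.log (q j) - Real.log (p j)) ≤ 0 ∧
      (∑ j, p j * (Real.log (q j) - Real.log (p j)) = 0 → q = p) := by
  have key : ∀ j, p j * (Real.log (q j) - Real.log (p j)) ≤ q j - p j := fun j => by
    rw [← Real.log_div (hq j).ne' (hp j).ne']
    have h := Real.log_le_sub_one_of_pos (div_pos (hq j) (hp j))
    have h' := mul_le_mul_of_nonneg_left h (hp j).le
    have : p j * (q j / p j - 1) = q j - p j := by have := (hp j).ne'; field_simp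
    linarith
  have hz : ∑ j, (q j - p j) = 0 := by rw [Finset.sum_sub_distrib, hsum, sub_self]
  refine ⟨(Finset.sum_le_sum fun j _ => key j).trans hz.le, fun h0 => ?_⟩
  have heq := (Finset.sum_eq_sum_iff_of_le fun j _ => key j).1 (h0.trans hz.symm)
  funext j
  by_contra hne
  have hne' : q j / p j ≠ 1 := fun h => hne (by rwa [div_eq_one_iff_eq (hp j).ne'] at h)
  have h := Real.log_lt_sub_one_of_pos (div_pos (hq j) (hp j)) hne'
  have h' := mul_lt_mul_of_pos_left h (hp j)
  have h1 : p j * (q j / p j - 1) = q j - p j := by have := (hp j).ne'; field_simp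
  have h2 := heq j (Finset.mem_univ j)
  rw [← Real.log_div (hq j).ne' (hp j).ne'] at h2
  linarith

/-! ### Concavity of the objective in logarithmic coordinates. -/

namespace CDMANetwork

variable {N : Type*}

theorem nodePower_pos (net : CDMANetwork N) (γ : N → ℝ) (i : N) : 0 < net.nodePower γ i :=
  Real.rpow_pos_of_pos (one_pos.trans (net.one_lt_peak i)) _

theorem log_nodePower (net : CDMANetwork N) (γ : N → ℝ) (i : N) :
    Real.log (net.nodePower γ i) = γ i * Real.log (net.peak i) :=
  Real.log_rpow (one_pos.trans (net.one_lt_peak i)) _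

theorem log_peak_pos (net : CDMANetwork N) (i : N) : 0 < Real.log (net.peak i) :=
  Real.log_pos (net.one_lt_peak i)

/-- The configurations at which the marginal gain indicators are defined. -/
def interiorSet (net : CDMANetwork N) : Set (net.Alloc × (N → ℝ)) :=
  {x | (∀ i j, 0 < x.1 i j) ∧ (∀ i, ∑ j, x.1 i j = 1) ∧ ∀ i, x.2 i ≤ 1}

theorem le_one_of_mem_interiorSet {net : CDMANetwork N} {x : net.Alloc × (N → ℝ)}
    (hx : x ∈ net.interiorSet) (i : N) (j : net.out i) : x.1 i j ≤ 1 := by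
  rw [← hx.2.1 i]
  exact Finset.single_le_sum (fun k _ => (hx.1 i k).le) (Finset.mem_univ j)

theorem nonempty_out_of_mem_interiorSet {net : CDMANetwork N} {x : net.Alloc × (N → ℝ)}
    (hx : x ∈ net.interiorSet) (i : N) : Nonempty (net.out i) := by
  by_contra h
  rw [not_nonempty_iff] at h
  have := hx.2.1 i
  simp at this

theorem continuous_nodePower (net : CDMANetwork N) (i : N) :
    Continuous fun x : net.Alloc × (N → ℝ) => net.nodePower x.2 i := by
  unfold nodePower
  exact Continuous.rpow continuous_const (by fun_prop)
    fun _ => Or.inl (one_pos.trans (net.one_lt_peak i)).ne'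

theorem continuous_alloc (net : CDMANetwork N) (i : N) (j : net.out i) :
    Continuous fun x : net.Alloc × (N → ℝ) => x.1 i j :=
  (continuous_apply j).comp ((continuous_apply i).comp continuous_fst)

variable [DecidableEq N]

/-- The interference that node `n` causes on the link `(m, k)`. -/
noncomputable def interference (net : CDMANetwork N) (η : net.Alloc) (γ : N → ℝ) (n m : N)
    (k : net.out m) : ℝ :=
  if n = m then net.θ m * net.gain m k * net.nodePower γ m * (1 - η m k)
  else net.gain n k * net.nodePower γ n

theorem interference_nonneg {net : CDMANetwork N} {x : net.Alloc × (N → ℝ)}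
    (hx : x ∈ net.interiorSet) (n m : N) (k : net.out m) :
    0 ≤ net.interference x.1 x.2 n m k := by
  have h1 := le_one_of_mem_interiorSet hx m k
  have h2 := net.nodePower_pos x.2
  unfold interference
  split_ifs
  · exact mul_nonneg (mul_nonneg (mul_nonneg (net.θ_nonneg m) (net.gain_nonneg m k)) (h2 m).le)
      (by linarith)
  · exact mul_nonneg (net.gain_nonneg _ _) (h2 n).le

variable [Fintype N]

theorem IN_eq_sum_interference (net : CDMANetwork N) (η : net.Alloc) (γ : N → ℝ) (m : N)
    (k : net.out m) :
    net.IN η γ m k = ∑ n, net.interference η γ n m k + net.noise k := by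
  rw [IN, ← Finset.add_sum_erase _ _ (Finset.mem_univ m)]
  congr 2
  · simp [interference]
  · exact Finset.sum_congr rfl fun n hn => by
      rw [interference, if_neg (Finset.ne_of_mem_erase hn)]

theorem noise_le_IN {net : CDMANetwork N} {x : net.Alloc × (N → ℝ)}
    (hx : x ∈ net.interiorSet) (m : N) (k : net.out m) : net.noise k ≤ net.IN x.1 x.2 m k := by
  rw [IN_eq_sum_interference]
  linarith [Finset.sum_nonneg fun n (_ : n ∈ Finset.univ) => interference_nonneg hx n m k]

theorem IN_pos {net : CDMANetwork N} {x : net.Alloc × (N → ℝ)}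
    (hx : x ∈ net.interiorSet) (m : N) (k : net.out m) : 0 < net.IN x.1 x.2 m k :=
  (net.noise_pos k).trans_le (noise_le_IN hx m k)

theorem SINR_pos {net : CDMANetwork N} {x : net.Alloc × (N → ℝ)}
    (hx : x ∈ net.interiorSet) (m : N) (k : net.out m) : 0 < net.SINR x.1 x.2 m k :=
  div_pos (mul_pos (mul_pos net.K_pos (net.gain_pos m k k.2))
    (mul_pos (net.nodePower_pos _ _) (hx.1 m k))) (IN_pos hx m k)

/-- The real-valued objective. -/
noncomputable def utility (net : CDMANetwork N) (x : net.Alloc × (N → ℝ)) : ℝ :=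
  ∑ i, ∑ j : net.out i, net.b i j * Real.log (net.SINR x.1 x.2 i j)

/-- Sensitivity of the self-interference terms of node `i`. -/
noncomputable def selfTerm (net : CDMANetwork N) (η : net.Alloc) (γ : N → ℝ) (i : N) : ℝ :=
  ∑ k : net.out i, net.b i k * (net.θ i * net.gain i k * net.nodePower γ i) / net.IN η γ i k

/-- Multiplication by the link power clears the singular term 1/P_ij, which leaves the form in which
the indicator enters the logarithmic first-order bound. -/
theorem power_mul_dEta {net : CDMANetwork N} {x : net.Alloc × (N → ℝ)}
    (hx : x ∈ net.interiorSet) (i : N) (j : net.out i) :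
    x.1 i j * (net.nodePower x.2 i * net.dEta x.1 x.2 i j) = net.b i j +
      net.b i j * (net.θ i * net.gain i j * net.nodePower x.2 i) / net.IN x.1 x.2 i j *
        x.1 i j := by
  have h1 := (hx.1 i j).ne'
  have h2 := (net.nodePower_pos x.2 i).ne'
  have h3 := (IN_pos hx i j).ne'
  rw [dEta, linkPower]
  field_simp

/-- This exhibits the indicator as the derivative in log P_n: the total weight of the links of n,
minus the weighted shares of n in the interference on all links. The self-interference parts of
`dEta` combine with the middle sum to give the share on the links of n itself. -/
theorem dGamma_eq {net : CDMANetwork N} {x : net.Alloc × (N → ℝ)}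
    (hx : x ∈ net.interiorSet) (n : N) :
    net.dGamma x.1 x.2 n = ∑ k : net.out n, net.b n k -
      ∑ m, ∑ k : net.out m,
        net.b m k * net.interference x.1 x.2 n m k / net.IN x.1 x.2 m k := by
  rw [dGamma, ← Finset.add_sum_erase _ _ (Finset.mem_univ n), mul_add, mul_add]
  have h1 : net.nodePower x.2 n * (∑ m ∈ Finset.univ.erase n, ∑ k : net.out m,
      -(net.b m k * net.gain n k) / net.IN x.1 x.2 m k) =
      -∑ m ∈ Finset.univ.erase n, ∑ k : net.out m,
        net.b m k * net.interference x.1 x.2 n m k / net.IN x.1 x.2 m k := by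
    rw [Finset.mul_sum, ← Finset.sum_neg_distrib]
    refine Finset.sum_congr rfl fun m hm => ?_
    rw [Finset.mul_sum, ← Finset.sum_neg_distrib]
    refine Finset.sum_congr rfl fun k _ => ?_
    rw [interference, if_neg (Finset.ne_of_mem_erase hm).symm]
    ring
  rw [h1, Finset.mul_sum, Finset.mul_sum]
  have h2 : ∑ k : net.out n, net.nodePower x.2 n *
        (-(net.θ n * net.b n k * net.gain n k) / net.IN x.1 x.2 n k) +
      ∑ k : net.out n, net.nodePower x.2 n * (net.dEta x.1 x.2 n k * x.1 n k) =
      ∑ k : net.out n, net.b n k - ∑ k : net.out n,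
        net.b n k * net.interference x.1 x.2 n n k / net.IN x.1 x.2 n k := by
    rw [← Finset.sum_add_distrib, ← Finset.sum_sub_distrib]
    refine Finset.sum_congr rfl fun k _ => ?_
    have := power_mul_dEta hx n k
    rw [show net.nodePower x.2 n * (net.dEta x.1 x.2 n k * x.1 n k) =
      x.1 n k * (net.nodePower x.2 n * net.dEta x.1 x.2 n k) by ring, this, interference,
      if_pos rfl]
    ring
  linarith

/-- The first-order bound for a single link, in logarithmic coordinates. -/
theorem log_SINR_sub_le {net : CDMANetwork N} {x y : net.Alloc × (N → ℝ)}
    (hx : x ∈ net.interiorSet) (hy : y ∈ net.interiorSet) (m : N) (k : net.out m) :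
    Real.log (net.SINR y.1 y.2 m k) - Real.log (net.SINR x.1 x.2 m k) ≤
      (y.2 m - x.2 m) * Real.log (net.peak m) + (Real.log (y.1 m k) - Real.log (x.1 m k)) -
      (∑ n, net.interference x.1 x.2 n m k * ((y.2 n - x.2 n) * Real.log (net.peak n)) +
        net.θ m * net.gain m k * net.nodePower x.2 m *
          (∑ l, x.1 m l * (Real.log (y.1 m l) - Real.log (x.1 m l)) -
            x.1 m k * (Real.log (y.1 m k) - Real.log (x.1 m k)))) / net.IN x.1 x.2 m k := by
  have hlog : ∀ z ∈ net.interiorSet, Real.log (net.SINR z.1 z.2 m k) =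
      Real.log (net.K * net.gain m k) + (z.2 m * Real.log (net.peak m) + Real.log (z.1 m k)) -
        Real.log (net.IN z.1 z.2 m k) := by
    intro z hz
    have hg : 0 < net.K * net.gain m k := mul_pos net.K_pos (net.gain_pos m k k.2)
    have hp := net.nodePower_pos z.2 m
    rw [SINR, linkPower, Real.log_div (mul_pos hg (mul_pos hp (hz.1 m k))).ne' (IN_pos hz m k).ne',
      Real.log_mul hg.ne' (mul_pos hp (hz.1 m k)).ne', Real.log_mul hp.ne' (hz.1 m k).ne',
      log_nodePower]
  rw [hlog x hx, hlog y hy]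
  set D : N → ℝ := fun n => (y.2 n - x.2 n) * Real.log (net.peak n) with hD
  set l : net.out m → ℝ := fun j => Real.log (y.1 m j) - Real.log (x.1 m j) with hl
  have hPexp : ∀ n, net.nodePower y.2 n = net.nodePower x.2 n * Real.exp (D n) := by
    intro n
    rw [← Real.exp_log (net.nodePower_pos y.2 n), ← Real.exp_log (net.nodePower_pos x.2 n),
      ← Real.exp_add, log_nodePower, log_nodePower]
    congr 1
    simp only [hD]; ring
  have hηexp : ∀ j, y.1 m j = x.1 m j * Real.exp (l j) := by
    intro j
    simp only [hl]
    rw [Real.exp_sub, Real.exp_log (hy.1 m j), Real.exp_log (hx.1 m j)]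
    have := (hx.1 m j).ne'
    field_simp
  -- The monomials of IN_mk: one for each other node, and one for each other share η_mj of node m,
  -- because 1 - η_mk is the sum of those shares.
  let a : N ⊕ net.out m → ℝ := Sum.elim
    (fun n => if n = m then 0 else net.gain n k * net.nodePower x.2 n)
    (fun j => if j = k then 0 else net.θ m * net.gain m k * net.nodePower x.2 m * x.1 m j)
  let e : N ⊕ net.out m → ℝ := Sum.elim D (fun j => D m + l j)
  have ha : ∀ t ∈ Finset.univ, 0 ≤ a t := by
    rintro (n | j) -
    · simp only [a, Sum.elim_inl]
      split_ifs
      · exact le_rfl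
      · exact mul_nonneg (net.gain_nonneg _ _) (net.nodePower_pos _ _).le
    · simp only [a, Sum.elim_inr]
      split_ifs
      · exact le_rfl
      · exact mul_nonneg (mul_nonneg (mul_nonneg (net.θ_nonneg m) (net.gain_nonneg m k))
          (net.nodePower_pos _ _).le) (hx.1 m j).le
  have hJ := sum_mul_div_le_log_sub_log Finset.univ a e ha (net.noise_pos k)
  have hite : ∀ f : N → ℝ, ∑ n, (if n = m then 0 else f n) = ∑ n ∈ Finset.univ.erase m, f n := by
    intro f
    rw [← Finset.add_sum_erase _ _ (Finset.mem_univ m), if_pos rfl, zero_add]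
    exact Finset.sum_congr rfl fun n hn => if_neg (Finset.ne_of_mem_erase hn)
  have hite' : ∀ f : net.out m → ℝ, ∑ j, (if j = k then 0 else f j) = ∑ j, f j - f k := by
    intro f
    rw [← Finset.add_sum_erase _ _ (Finset.mem_univ k), if_pos rfl, zero_add,
      ← Finset.add_sum_erase _ f (Finset.mem_univ k), add_sub_cancel_left]
    exact Finset.sum_congr rfl fun n hn => if_neg (Finset.ne_of_mem_erase hn)
  have h1 : ∑ t, a t + net.noise k = net.IN x.1 x.2 m k := by
    rw [Fintype.sum_sum_type]
    simp only [a, Sum.elim_inl, Sum.elim_inr]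
    rw [hite, hite', ← Finset.mul_sum, hx.2.1 m, IN]
    ring
  have h2 : ∑ t, a t * Real.exp (e t) + net.noise k = net.IN y.1 y.2 m k := by
    rw [Fintype.sum_sum_type]
    simp only [a, e, Sum.elim_inl, Sum.elim_inr, ite_mul, zero_mul, Real.exp_add]
    rw [hite, hite']
    have e1 : ∀ j, net.θ m * net.gain m k * net.nodePower x.2 m * x.1 m j *
        (Real.exp (D m) * Real.exp (l j)) =
        net.θ m * net.gain m k * net.nodePower y.2 m * y.1 m j := by
      intro j
      rw [hPexp, hηexp]; ring
    have e2 : ∀ n, net.gain n k * net.nodePower x.2 n * Real.exp (D n) =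
        net.gain n k * net.nodePower y.2 n := by
      intro n
      rw [hPexp]; ring
    simp only [e1, e2]
    rw [← Finset.mul_sum, hy.2.1 m, IN]
    ring
  have h3 : ∑ t, a t * e t = ∑ n, net.interference x.1 x.2 n m k * D n +
      net.θ m * net.gain m k * net.nodePower x.2 m * (∑ j, x.1 m j * l j - x.1 m k * l k) := by
    rw [Fintype.sum_sum_type]
    simp only [a, e, Sum.elim_inl, Sum.elim_inr, ite_mul, zero_mul]
    rw [hite, hite', ← Finset.add_sum_erase _ (fun n => net.interference x.1 x.2 n m k * D n)
      (Finset.mem_univ m)]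
    have e1 : ∑ n ∈ Finset.univ.erase m, net.interference x.1 x.2 n m k * D n =
        ∑ n ∈ Finset.univ.erase m, net.gain n k * net.nodePower x.2 n * D n :=
      Finset.sum_congr rfl fun n hn => by
        rw [interference, if_neg (Finset.ne_of_mem_erase hn)]
    have e2 : ∑ j, net.θ m * net.gain m k * net.nodePower x.2 m * x.1 m j * (D m + l j) =
        net.θ m * net.gain m k * net.nodePower x.2 m * (D m + ∑ j, x.1 m j * l j) := by
      have : D m = ∑ j, x.1 m j * D m := by rw [← Finset.sum_mul, hx.2.1 m, one_mul]
      conv_rhs => rw [this]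
      rw [← Finset.sum_add_distrib, Finset.mul_sum]
      exact Finset.sum_congr rfl fun j _ => by ring
    rw [e1, e2, interference, if_pos rfl]
    ring
  rw [h1, h2, h3] at hJ
  have hD' : D m = (y.2 m - x.2 m) * Real.log (net.peak m) := rfl
  have hl' : l k = Real.log (y.1 m k) - Real.log (x.1 m k) := rfl
  linarith

/-- The objective is concave in logarithmic coordinates: the first-order bound. -/
theorem utility_sub_le {net : CDMANetwork N} {x y : net.Alloc × (N → ℝ)}
    (hx : x ∈ net.interiorSet) (hy : y ∈ net.interiorSet) :
    net.utility y - net.utility x ≤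
      ∑ n, net.dGamma x.1 x.2 n * ((y.2 n - x.2 n) * Real.log (net.peak n)) +
      ∑ m, ∑ k, x.1 m k * (net.nodePower x.2 m * net.dEta x.1 x.2 m k -
        net.selfTerm x.1 x.2 m) * (Real.log (y.1 m k) - Real.log (x.1 m k)) := by
  set D : N → ℝ := fun n => (y.2 n - x.2 n) * Real.log (net.peak n) with hD
  set l : (m : N) → net.out m → ℝ := fun m j => Real.log (y.1 m j) - Real.log (x.1 m j) with hl
  have h1 : net.utility y - net.utility x ≤ ∑ m, ∑ k : net.out m, net.b m k * (D m + l m k -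
      (∑ n, net.interference x.1 x.2 n m k * D n + net.θ m * net.gain m k * net.nodePower x.2 m *
        (∑ j, x.1 m j * l m j - x.1 m k * l m k)) / net.IN x.1 x.2 m k) := by
    rw [utility, utility, ← Finset.sum_sub_distrib]
    refine Finset.sum_le_sum fun m _ => ?_
    rw [← Finset.sum_sub_distrib]
    refine Finset.sum_le_sum fun k _ => ?_
    rw [← mul_sub]
    exact mul_le_mul_of_nonneg_left (log_SINR_sub_le hx hy m k) (net.b_pos m k k.2).le
  refine h1.trans (le_of_eq ?_)
  have h2 : ∑ n, net.dGamma x.1 x.2 n * D n = ∑ m, ∑ k : net.out m, (net.b m k * D m -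
      net.b m k * (∑ n, net.interference x.1 x.2 n m k * D n) / net.IN x.1 x.2 m k) := by
    simp only [dGamma_eq hx, sub_mul, Finset.sum_sub_distrib, Finset.sum_mul]
    congr 1
    rw [Finset.sum_comm]
    refine Finset.sum_congr rfl fun m _ => ?_
    rw [Finset.sum_comm]
    refine Finset.sum_congr rfl fun k _ => ?_
    rw [Finset.mul_sum, Finset.sum_div]
    exact Finset.sum_congr rfl fun n _ => by ring
  rw [h2, ← Finset.sum_add_distrib]
  refine Finset.sum_congr rfl fun m _ => ?_
  -- The inner sum over all shares is the same for every link of m, so its coefficients add up to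
  -- `selfTerm`.
  have h3 : ∑ k, x.1 m k * (net.nodePower x.2 m * net.dEta x.1 x.2 m k -
        net.selfTerm x.1 x.2 m) * l m k = ∑ k : net.out m, (net.b m k + net.b m k *
        (net.θ m * net.gain m k * net.nodePower x.2 m) / net.IN x.1 x.2 m k * x.1 m k) * l m k -
        ∑ k : net.out m, net.b m k * (net.θ m * net.gain m k * net.nodePower x.2 m) /
          net.IN x.1 x.2 m k * ∑ j, x.1 m j * l m j := by
    rw [← Finset.sum_mul]
    change _ = _ - net.selfTerm x.1 x.2 m * _
    rw [Finset.mul_sum, ← Finset.sum_sub_distrib]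
    refine Finset.sum_congr rfl fun k _ => ?_
    rw [← power_mul_dEta hx]
    ring
  rw [h3, ← Finset.sum_sub_distrib, ← Finset.sum_add_distrib]
  exact Finset.sum_congr rfl fun k _ => by ring

end CDMANetwork

/-! ### The iteration map and its continuity. -/

namespace CDMANetwork

variable {N : Type*} [Fintype N] [DecidableEq N]

/-- The direction of the unscaled power allocation step. -/
noncomputable def allocDir (net : CDMANetwork N) (x : net.Alloc × (N → ℝ)) (i : N)
    (j : net.out i) : ℝ :=
  net.dEta x.1 x.2 i j - (∑ k, net.dEta x.1 x.2 i k) / Fintype.card (net.out i)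

/-- One simultaneous step of power allocation with stepsizes `p (inl i)` and of power control with
stepsizes `p (inr i)`. -/
noncomputable def step (net : CDMANetwork N) (x : net.Alloc × (N → ℝ)) (p : N ⊕ N → ℝ) :
    net.Alloc × (N → ℝ) :=
  (fun i j => x.1 i j + p (Sum.inl i) * net.allocDir x i j,
    fun i => min 1 (x.2 i + p (Sum.inr i) * net.dGamma x.1 x.2 i))

theorem step_fst_apply (net : CDMANetwork N) (x : net.Alloc × (N → ℝ)) (p : N ⊕ N → ℝ) (i : N)
    (j : net.out i) : (net.step x p).1 i j = x.1 i j + p (Sum.inl i) * net.allocDir x i j :=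
  rfl

theorem step_snd_apply (net : CDMANetwork N) (x : net.Alloc × (N → ℝ)) (p : N ⊕ N → ℝ) (i : N) :
    (net.step x p).2 i = min 1 (x.2 i + p (Sum.inr i) * net.dGamma x.1 x.2 i) :=
  rfl

/-- First-order optimality conditions at a configuration with positive allocations. -/
def Stationary (net : CDMANetwork N) (x : net.Alloc × (N → ℝ)) : Prop :=
  (∀ i j, net.allocDir x i j = 0) ∧
    ∀ i, 0 ≤ net.dGamma x.1 x.2 i ∧ (x.2 i < 1 → net.dGamma x.1 x.2 i = 0)

theorem sum_allocDir {net : CDMANetwork N} {x : net.Alloc × (N → ℝ)}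
    (hx : x ∈ net.interiorSet) (i : N) : ∑ j, net.allocDir x i j = 0 := by
  have := nonempty_out_of_mem_interiorSet hx i
  have hc : (Fintype.card (net.out i) : ℝ) ≠ 0 := Nat.cast_ne_zero.2 Fintype.card_ne_zero
  simp only [allocDir, Finset.sum_sub_distrib, Finset.sum_const, Finset.card_univ, nsmul_eq_mul]
  field_simp
  ring

/-- Positivity is the only constraint that a step can violate: the directions sum to zero and the
power control is truncated. -/
theorem step_mem_interiorSet {net : CDMANetwork N} {x : net.Alloc × (N → ℝ)}
    (hx : x ∈ net.interiorSet) {p : N ⊕ N → ℝ} (hp : ∀ i j, 0 < (net.step x p).1 i j) :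
    net.step x p ∈ net.interiorSet := by
  refine ⟨hp, fun i => ?_, fun i => min_le_left _ _⟩
  simp only [step]
  rw [Finset.sum_add_distrib, ← Finset.mul_sum, sum_allocDir hx, hx.2.1, mul_zero, add_zero]

theorem step_zero {net : CDMANetwork N} {x : net.Alloc × (N → ℝ)}
    (hx : x ∈ net.interiorSet) : net.step x 0 = x := by
  refine Prod.ext ?_ ?_
  · funext i j; simp [step]
  · funext i; simp [step, hx.2.2 i]

theorem Stationary.step_eq {net : CDMANetwork N} {x : net.Alloc × (N → ℝ)}
    (hx : x ∈ net.interiorSet) (h : net.Stationary x) {p : N ⊕ N → ℝ} (hp : ∀ b, 0 ≤ p b) :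
    net.step x p = x := by
  refine Prod.ext ?_ ?_
  · funext i j; simp [step, h.1]
  · funext i
    obtain ⟨h1, h2⟩ := h.2 i
    rcases (hx.2.2 i).lt_or_eq with hlt | heq
    · simp [step, h2 hlt, hlt.le]
    · simp [step, heq, mul_nonneg (hp (Sum.inr i)) h1]

section continuity

variable (net : CDMANetwork N)

theorem continuous_IN (m : N) (k : net.out m) :
    Continuous fun x : net.Alloc × (N → ℝ) => net.IN x.1 x.2 m k := by
  unfold IN
  have h1 := net.continuous_nodePower
  have h2 := net.continuous_alloc m k
  fun_prop

variable {net} {x : net.Alloc × (N → ℝ)}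

theorem continuousAt_dEta (hx : x ∈ net.interiorSet) (i : N) (j : net.out i) :
    ContinuousAt (fun x : net.Alloc × (N → ℝ) => net.dEta x.1 x.2 i j) x := by
  unfold dEta linkPower
  refine continuousAt_const.mul (ContinuousAt.add ?_ ?_)
  · exact continuousAt_const.div
      ((net.continuous_nodePower i).mul (net.continuous_alloc i j)).continuousAt
      (mul_pos (net.nodePower_pos _ _) (hx.1 i j)).ne'
  · exact continuousAt_const.div (net.continuous_IN i j).continuousAt (IN_pos hx i j).ne'

theorem continuousAt_dGamma (hx : x ∈ net.interiorSet) (i : N) :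
    ContinuousAt (fun x : net.Alloc × (N → ℝ) => net.dGamma x.1 x.2 i) x := by
  have h1 : ∀ m (k : net.out m) (c : ℝ),
      ContinuousAt (fun x : net.Alloc × (N → ℝ) => c / net.IN x.1 x.2 m k) x := fun m k c =>
    continuousAt_const.div (net.continuous_IN m k).continuousAt (IN_pos hx m k).ne'
  unfold dGamma
  refine (net.continuous_nodePower i).continuousAt.mul
    (ContinuousAt.add (ContinuousAt.add ?_ ?_) ?_)
  · exact tendsto_finsetSum _ fun m _ => tendsto_finsetSum _ fun k _ => h1 m k _
  · exact tendsto_finsetSum _ fun k _ => h1 i k _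
  · exact tendsto_finsetSum _ fun k _ =>
      (continuousAt_dEta hx i k).mul (net.continuous_alloc i k).continuousAt

theorem continuousAt_selfTerm (hx : x ∈ net.interiorSet) (i : N) :
    ContinuousAt (fun x : net.Alloc × (N → ℝ) => net.selfTerm x.1 x.2 i) x := by
  unfold selfTerm
  exact tendsto_finsetSum _ fun k _ => (continuousAt_const.mul
    (continuousAt_const.mul (net.continuous_nodePower i).continuousAt)).div
    (net.continuous_IN i k).continuousAt (IN_pos hx i k).ne'

theorem continuousAt_allocDir (hx : x ∈ net.interiorSet) (i : N) (j : net.out i) :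
    ContinuousAt (fun x => net.allocDir x i j) x := by
  unfold allocDir
  exact (continuousAt_dEta hx i j).sub
    (ContinuousAt.div_const (tendsto_finsetSum _ fun k _ => continuousAt_dEta hx i k) _)

theorem continuousAt_utility (hx : x ∈ net.interiorSet) : ContinuousAt net.utility x := by
  unfold utility
  refine tendsto_finsetSum _ fun i _ => tendsto_finsetSum _ fun j _ => ?_
  refine ContinuousAt.mul continuousAt_const (ContinuousAt.log ?_ (SINR_pos hx i j).ne')
  unfold SINR linkPower
  exact (continuousAt_const.mul ((net.continuous_nodePower i).mul
    (net.continuous_alloc i j)).continuousAt).div (net.continuous_IN i j).continuousAt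
    (IN_pos hx i j).ne'

theorem continuousAt_step (hx : x ∈ net.interiorSet) (p : N ⊕ N → ℝ) :
    ContinuousAt (fun q : (net.Alloc × (N → ℝ)) × (N ⊕ N → ℝ) => net.step q.1 q.2) (x, p) := by
  have hp : ∀ b, ContinuousAt
      (fun q : (net.Alloc × (N → ℝ)) × (N ⊕ N → ℝ) => q.2 b) (x, p) := fun b =>
    ((continuous_apply b).comp continuous_snd).continuousAt
  have hfst : ∀ {f : net.Alloc × (N → ℝ) → ℝ}, ContinuousAt f x → ContinuousAt
      (fun q : (net.Alloc × (N → ℝ)) × (N ⊕ N → ℝ) => f q.1) (x, p) := fun hf =>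
    ContinuousAt.comp (x := (x, p)) (f := Prod.fst) hf continuousAt_fst
  refine ContinuousAt.prodMk ?_ ?_
  · refine continuousAt_pi.2 fun i => continuousAt_pi.2 fun j => ?_
    exact (hfst (net.continuous_alloc i j).continuousAt).add
      ((hp _).mul (hfst (continuousAt_allocDir hx i j)))
  · refine continuousAt_pi.2 fun i => ?_
    refine continuousAt_const.min
      (ContinuousAt.add ?_ ((hp _).mul (hfst (continuousAt_dGamma hx i))))
    exact hfst (f := fun x => x.2 i) ((continuous_apply i).comp continuous_snd).continuousAt

theorem eventually_step_mem (hx : x ∈ net.interiorSet) {p : N ⊕ N → ℝ}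
    (hp : net.step x p ∈ net.interiorSet) :
    ∀ᶠ q : (net.Alloc × (N → ℝ)) × (N ⊕ N → ℝ) in 𝓝 (x, p),
      q.1 ∈ net.interiorSet → net.step q.1 q.2 ∈ net.interiorSet := by
  have h : ∀ᶠ q : (net.Alloc × (N → ℝ)) × (N ⊕ N → ℝ) in 𝓝 (x, p),
      ∀ i j, 0 < (net.step q.1 q.2).1 i j := by
    refine eventually_all.2 fun i => eventually_all.2 fun j => ?_
    exact ((net.continuous_alloc i j).continuousAt.tendsto.comp
      (continuousAt_step hx p).tendsto).eventually (lt_mem_nhds (hp.1 i j))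
  filter_upwards [h] with q hq hq1 using step_mem_interiorSet hq1 hq

theorem tendsto_step_single (hx : x ∈ net.interiorSet) (b : N ⊕ N) :
    Tendsto (fun s : ℝ => net.step x (Pi.single b s)) (𝓝[>] 0) (𝓝 x) := by
  have h1 : Tendsto (fun s : ℝ => (x, (Pi.single b s : N ⊕ N → ℝ))) (𝓝 0) (𝓝 (x, 0)) := by
    refine tendsto_const_nhds.prodMk_nhds ?_
    have := (continuous_single (A := fun _ : N ⊕ N => ℝ) b).tendsto (0 : ℝ)
    rwa [Pi.single_zero] at this
  have h2 := (continuousAt_step hx 0).tendsto.comp h1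
  rw [step_zero hx] at h2
  exact h2.mono_left nhdsWithin_le_nhds

end continuity

/-! ### Stationarity, optimality and uniqueness. -/

section optimality

variable {net : CDMANetwork N} {x y : net.Alloc × (N → ℝ)}

/-- Total weight of node `i`, discounted by its self-interference. -/
theorem sum_alloc_mul_sub_selfTerm_pos (hx : x ∈ net.interiorSet) (i : N) :
    0 < ∑ k, x.1 i k * (net.nodePower x.2 i * net.dEta x.1 x.2 i k - net.selfTerm x.1 x.2 i) := by
  have := nonempty_out_of_mem_interiorSet hx i
  have h1 : ∑ k, x.1 i k * (net.nodePower x.2 i * net.dEta x.1 x.2 i k -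
      net.selfTerm x.1 x.2 i) = ∑ k : net.out i, net.b i k *
        (1 - net.interference x.1 x.2 i i k / net.IN x.1 x.2 i k) := by
    simp only [mul_sub, power_mul_dEta hx, Finset.sum_sub_distrib]
    rw [← Finset.sum_mul, hx.2.1, one_mul, selfTerm, ← Finset.sum_sub_distrib,
      ← Finset.sum_sub_distrib]
    refine Finset.sum_congr rfl fun k _ => ?_
    rw [interference, if_pos rfl]
    ring
  rw [h1]
  refine Finset.sum_pos (fun k _ => mul_pos (net.b_pos i k k.2) ?_) Finset.univ_nonempty
  -- The interference of a node on its own link is only a part of IN, and the noise makes the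
  -- inequality strict.
  rw [sub_pos, div_lt_one (IN_pos hx i k), IN_eq_sum_interference]
  have := Finset.single_le_sum (fun n _ => interference_nonneg hx n i k) (Finset.mem_univ i)
  linarith [net.noise_pos k]

/-- A stationary configuration is optimal, and the optimal allocation is unique. -/
theorem Stationary.utility_le_and_alloc_eq (hx : x ∈ net.interiorSet) (hy : y ∈ net.interiorSet)
    (h : net.Stationary x) :
    net.utility y ≤ net.utility x ∧ (net.utility x ≤ net.utility y → y.1 = x.1) := by
  have hMI := utility_sub_le hx hy
  have h1 : ∑ n, net.dGamma x.1 x.2 n * ((y.2 n - x.2 n) * Real.log (net.peak n)) ≤ 0 := by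
    refine Finset.sum_nonpos fun n _ => ?_
    obtain ⟨h1, h2⟩ := h.2 n
    rcases (hx.2.2 n).lt_or_eq with hlt | heq
    · rw [h2 hlt, zero_mul]
    · refine mul_nonpos_of_nonneg_of_nonpos h1
        (mul_nonpos_of_nonpos_of_nonneg ?_ (net.log_peak_pos n).le)
      linarith [hy.2.2 n]
  -- At a stationary point the indicators agree on all links of m, so the bracket is a constant κ.
  -- It is positive because its average over the shares is.
  have h2 : ∀ m, ∃ κ > 0, ∑ k, x.1 m k * (net.nodePower x.2 m * net.dEta x.1 x.2 m k -
        net.selfTerm x.1 x.2 m) * (Real.log (y.1 m k) - Real.log (x.1 m k)) =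
      κ * ∑ k, x.1 m k * (Real.log (y.1 m k) - Real.log (x.1 m k)) := by
    intro m
    have hd : ∀ k, net.dEta x.1 x.2 m k =
        (∑ k, net.dEta x.1 x.2 m k) / Fintype.card (net.out m) := fun k =>
      sub_eq_zero.1 (h.1 m k)
    set lam := (∑ k, net.dEta x.1 x.2 m k) / Fintype.card (net.out m)
    have hpos := sum_alloc_mul_sub_selfTerm_pos hx m
    simp only [hd] at hpos ⊢
    rw [← Finset.sum_mul, hx.2.1, one_mul] at hpos
    refine ⟨_, hpos, ?_⟩
    rw [Finset.mul_sum]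
    exact Finset.sum_congr rfl fun k _ => by ring
  have hG : ∀ m, _ := fun m => sum_mul_log_sub_log_nonpos (hx.1 m) (hy.1 m)
    ((hy.2.1 m).trans (hx.2.1 m).symm)
  have h3 : ∀ m ∈ Finset.univ, ∑ k, x.1 m k * (net.nodePower x.2 m * net.dEta x.1 x.2 m k -
        net.selfTerm x.1 x.2 m) * (Real.log (y.1 m k) - Real.log (x.1 m k)) ≤ 0 := by
    intro m _
    obtain ⟨κ, hκ, he⟩ := h2 m
    rw [he]
    exact mul_nonpos_of_nonneg_of_nonpos hκ.le (hG m).1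
  have h4 := Finset.sum_nonpos h3
  refine ⟨by linarith, fun hle => ?_⟩
  have h5 := (Finset.sum_eq_zero_iff_of_nonpos h3).1 (by linarith)
  funext m
  obtain ⟨κ, hκ, he⟩ := h2 m
  have h6 := h5 m (Finset.mem_univ m)
  rw [he] at h6
  exact (hG m).2 ((mul_eq_zero.1 h6).resolve_left hκ.ne')

/-- Of two stationary configurations with equal allocations, neither has a larger power control
variable at any node. -/
theorem Stationary.control_le (hx : x ∈ net.interiorSet) (hy : y ∈ net.interiorSet)
    (hxs : net.Stationary x) (hys : net.Stationary y) (hxy : y.1 = x.1) (i : N) :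
    y.2 i ≤ x.2 i := by
  by_contra! hlt
  have : Nonempty N := ⟨i⟩
  -- At the node of maximal power ratio ρ > 1, its own interference is multiplied by ρ and every
  -- other by at most ρ. The noise is not scaled, so IN grows by strictly less than ρ and no share
  -- of n decreases.
  obtain ⟨n, hn⟩ := Finite.exists_max fun n => net.nodePower y.2 n / net.nodePower x.2 n
  set ρ := net.nodePower y.2 n / net.nodePower x.2 n with hρ
  have hPx := net.nodePower_pos x.2
  have hPy := net.nodePower_pos y.2
  have hρ1 : 1 < ρ := by
    refine lt_of_lt_of_le ?_ (hn i)
    rw [one_lt_div (hPx i)]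
    exact Real.rpow_lt_rpow_of_exponent_lt (net.one_lt_peak i) hlt
  have hxn : x.2 n < 1 := by
    refine lt_of_lt_of_le ?_ (hy.2.2 n)
    rw [hρ, one_lt_div (hPx n)] at hρ1
    exact (Real.rpow_lt_rpow_left_iff (net.one_lt_peak n)).1 hρ1
  have hle : ∀ l m (k : net.out m), net.interference y.1 y.2 l m k ≤
      ρ * net.interference x.1 x.2 l m k := by
    intro l m k
    have hl : net.nodePower y.2 l ≤ ρ * net.nodePower x.2 l := by
      have := hn l
      rwa [div_le_iff₀ (hPx l)] at this
    unfold interference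
    rw [hxy]
    have h1 := le_one_of_mem_interiorSet hx m k
    split_ifs with hlm
    · subst hlm
      have : 0 ≤ net.θ l * net.gain l k * (1 - x.1 l k) :=
        mul_nonneg (mul_nonneg (net.θ_nonneg l) (net.gain_nonneg l k)) (by linarith)
      nlinarith [mul_le_mul_of_nonneg_left hl this]
    · nlinarith [mul_le_mul_of_nonneg_left hl (net.gain_nonneg l k)]
  have heq : ∀ m (k : net.out m), net.interference y.1 y.2 n m k =
      ρ * net.interference x.1 x.2 n m k := by
    intro m k
    have hl : net.nodePower y.2 n = ρ * net.nodePower x.2 n := by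
      rw [hρ, div_mul_cancel₀ _ (hPx n).ne']
    unfold interference
    rw [hxy]
    split_ifs with hlm
    · subst hlm
      rw [hl]; ring
    · rw [hl]; ring
  have hIN : ∀ m (k : net.out m), net.IN y.1 y.2 m k < ρ * net.IN x.1 x.2 m k := by
    intro m k
    rw [IN_eq_sum_interference, IN_eq_sum_interference, mul_add, Finset.mul_sum]
    have h1 := Finset.sum_le_sum fun l (_ : l ∈ Finset.univ) => hle l m k
    have h2 := net.noise_pos k
    nlinarith
  have hterm : ∀ m (k : net.out m),
      net.b m k * net.interference x.1 x.2 n m k / net.IN x.1 x.2 m k ≤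
        net.b m k * net.interference y.1 y.2 n m k / net.IN y.1 y.2 m k ∧
      (net.b m k * net.interference x.1 x.2 n m k / net.IN x.1 x.2 m k =
        net.b m k * net.interference y.1 y.2 n m k / net.IN y.1 y.2 m k →
        net.b m k * net.interference x.1 x.2 n m k / net.IN x.1 x.2 m k = 0) := by
    intro m k
    have hx0 := IN_pos hx m k
    have hy0 := IN_pos hy m k
    set a := net.b m k * net.interference x.1 x.2 n m k with ha
    have ha0 : 0 ≤ a := mul_nonneg (net.b_pos m k k.2).le (interference_nonneg hx n m k)
    have hay : net.b m k * net.interference y.1 y.2 n m k = ρ * a := by rw [heq, ha]; ring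
    rw [hay]
    constructor
    · rw [div_le_div_iff₀ hx0 hy0]
      nlinarith [mul_le_mul_of_nonneg_left (hIN m k).le ha0]
    · intro h
      rw [div_eq_div_iff hx0.ne' hy0.ne'] at h
      have h1 : a * (ρ * net.IN x.1 x.2 m k - net.IN y.1 y.2 m k) = 0 := by linarith
      have h2 := (mul_eq_zero.1 h1).resolve_right (by linarith [hIN m k])
      rw [h2, zero_div]
  have hgx := dGamma_eq hx n
  rw [(hxs.2 n).2 hxn] at hgx
  have hgy := dGamma_eq hy n
  have hgy0 := (hys.2 n).1
  have hsum1 : ∀ m ∈ Finset.univ, ∑ k : net.out m,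
      net.b m k * net.interference x.1 x.2 n m k / net.IN x.1 x.2 m k ≤
      ∑ k : net.out m, net.b m k * net.interference y.1 y.2 n m k / net.IN y.1 y.2 m k :=
    fun m _ => Finset.sum_le_sum fun k _ => (hterm m k).1
  have hs := Finset.sum_le_sum hsum1
  -- The indicator of n vanishes at x, where n is below peak, and is nonnegative at y. So no share
  -- grows, which is possible only if all shares vanish; but then the indicator at x would be the
  -- positive total weight.
  have he := (Finset.sum_eq_sum_iff_of_le hsum1).1 (by linarith)
  have hzero : ∑ m, ∑ k : net.out m,
      net.b m k * net.interference x.1 x.2 n m k / net.IN x.1 x.2 m k = 0 := by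
    refine Finset.sum_eq_zero fun m hm => Finset.sum_eq_zero fun k hk => ?_
    exact (hterm m k).2 ((Finset.sum_eq_sum_iff_of_le fun k _ => (hterm m k).1).1 (he m hm) k hk)
  have := nonempty_out_of_mem_interiorSet hx n
  have hb : 0 < ∑ k : net.out n, net.b n k :=
    Finset.sum_pos (fun k _ => net.b_pos n k k.2) Finset.univ_nonempty
  linarith

/-- Power control steps of a single node improve the objective unless the node is stationary. -/
theorem dGamma_of_stuck (hx : x ∈ net.interiorSet)
    (h : BlockAscent.Stuck net.interiorSet net.utility net.step x) (i : N) :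
    0 ≤ net.dGamma x.1 x.2 i ∧ (x.2 i < 1 → net.dGamma x.1 x.2 i = 0) := by
  let y : ℝ → net.Alloc × (N → ℝ) := fun s => net.step x (Pi.single (Sum.inr i) s)
  have hη : ∀ s, (y s).1 = x.1 := fun s => by funext m k; simp [y, step]
  have hγ : ∀ s m, m ≠ i → (y s).2 m = x.2 m := fun s m hm => by
    simp [y, step, hm, hx.2.2 m]
  have hγi : ∀ s, (y s).2 i = min 1 (x.2 i + s * net.dGamma x.1 x.2 i) := fun s => by
    simp [y, step]
  have hyD : ∀ s, y s ∈ net.interiorSet := fun s =>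
    step_mem_interiorSet hx fun m k => by
      change 0 < (y s).1 m k
      rw [hη]; exact hx.1 m k
  have hlim : Tendsto (fun s => net.dGamma (y s).1 (y s).2 i) (𝓝[>] 0)
      (𝓝 (net.dGamma x.1 x.2 i)) :=
    (continuousAt_dGamma hx i).tendsto.comp (tendsto_step_single hx (Sum.inr i))
  -- The first-order bound is based at the new point and compared with x. This gives the sign of the
  -- indicator there, and continuity as s → 0 carries it to x without differentiating the objective.
  have key : ∀ s, 0 < s → 0 ≤ net.dGamma (y s).1 (y s).2 i * (x.2 i - (y s).2 i) := by
    intro s hs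
    have h1 := h (Sum.inr i) s hs (hyD s)
    have h2 := utility_sub_le (hyD s) hx
    have h3 : ∑ m, ∑ k, (y s).1 m k * (net.nodePower (y s).2 m * net.dEta (y s).1 (y s).2 m k -
        net.selfTerm (y s).1 (y s).2 m) * (Real.log (x.1 m k) - Real.log ((y s).1 m k)) = 0 :=
      Finset.sum_eq_zero fun m _ => Finset.sum_eq_zero fun k _ => by
        rw [hη s, sub_self, mul_zero]
    rw [h3, Finset.sum_eq_single i (fun m _ hm => by rw [hγ s m hm, sub_self, zero_mul, mul_zero])
      (fun hi => absurd (Finset.mem_univ i) hi), add_zero, ← mul_assoc] at h2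
    change net.utility (y s) ≤ _ at h1
    exact nonneg_of_mul_nonneg_left (by linarith) (net.log_peak_pos i)
  have hnn : 0 ≤ net.dGamma x.1 x.2 i := by
    by_contra! hneg
    obtain ⟨s, hs, hs0⟩ := ((hlim.eventually (gt_mem_nhds hneg)).and self_mem_nhdsWithin).exists
    have h1 := key s hs0
    have h2 : (y s).2 i < x.2 i := by
      rw [hγi]
      exact min_lt_of_right_lt (by nlinarith [mul_neg_of_pos_of_neg hs0 hneg])
    nlinarith [mul_neg_of_neg_of_pos hs (sub_pos.2 h2)]
  refine ⟨hnn, fun hlt => ?_⟩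
  by_contra hne
  have hpos := lt_of_le_of_ne hnn (Ne.symm hne)
  obtain ⟨s, hs, hs0⟩ := ((hlim.eventually (lt_mem_nhds hpos)).and self_mem_nhdsWithin).exists
  have h1 := key s hs0
  have h2 : x.2 i < (y s).2 i := by
    rw [hγi]
    exact lt_min hlt (by nlinarith [mul_pos hs0 hpos])
  nlinarith [mul_pos hs (sub_pos.2 h2)]

/-- Power allocation steps of a single node improve the objective unless the node is
stationary. -/
theorem allocDir_of_stuck (hx : x ∈ net.interiorSet)
    (h : BlockAscent.Stuck net.interiorSet net.utility net.step x) (i : N) (j : net.out i) :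
    net.allocDir x i j = 0 := by
  let y : ℝ → net.Alloc × (N → ℝ) := fun s => net.step x (Pi.single (Sum.inl i) s)
  have hη : ∀ s m, m ≠ i → (y s).1 m = x.1 m := fun s m hm => by
    funext k; simp [y, step, hm]
  have hηi : ∀ s k, (y s).1 i k = x.1 i k + s * net.allocDir x i k := fun s k => by
    simp [y, step]
  have hγ : ∀ s, (y s).2 = x.2 := fun s => by funext m; simp [y, step, hx.2.2 m]
  have hlim : Tendsto y (𝓝[>] 0) (𝓝 x) := tendsto_step_single hx (Sum.inl i)
  have hyD : ∀ᶠ s in 𝓝[>] 0, y s ∈ net.interiorSet := by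
    have : ∀ᶠ s in 𝓝[>] 0, ∀ m k, 0 < (y s).1 m k :=
      eventually_all.2 fun m => eventually_all.2 fun k =>
        ((net.continuous_alloc m k).continuousAt.tendsto.comp hlim).eventually
          (lt_mem_nhds (hx.1 m k))
    filter_upwards [this] with s hs using step_mem_interiorSet hx hs
  let w : net.Alloc × (N → ℝ) → net.out i → ℝ := fun z k => z.1 i k *
    (net.nodePower z.2 i * net.dEta z.1 z.2 i k - net.selfTerm z.1 z.2 i)
  have hw : ∀ k, Tendsto (fun s => w (y s) k) (𝓝[>] 0) (𝓝 (w x k)) := fun k => by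
    have : ContinuousAt (fun z => w z k) x := (net.continuous_alloc i k).continuousAt.mul
      (((net.continuous_nodePower i).continuousAt.mul (continuousAt_dEta hx i k)).sub
        (continuousAt_selfTerm hx i))
    exact this.tendsto.comp hlim
  -- Again the bound is based at the new point; division by s turns the logarithmic differences into
  -- quotients with a limit.
  have key : ∀ᶠ s in 𝓝[>] 0, ∑ k, w (y s) k * (s⁻¹ *
      (Real.log (x.1 i k + s * net.allocDir x i k) - Real.log (x.1 i k))) ≤ 0 := by
    filter_upwards [hyD, self_mem_nhdsWithin] with s hs hs0
    have hs0' : (0 : ℝ) < s := hs0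
    have h1 := h (Sum.inl i) s hs0 hs
    have h2 := utility_sub_le hs hx
    have h3 : ∑ n, net.dGamma (y s).1 (y s).2 n *
        ((x.2 n - (y s).2 n) * Real.log (net.peak n)) = 0 :=
      Finset.sum_eq_zero fun n _ => by rw [hγ s, sub_self, zero_mul, mul_zero]
    rw [h3, zero_add, Finset.sum_eq_single i (fun m _ hm => Finset.sum_eq_zero fun k _ => by
      rw [hη s m hm, sub_self, mul_zero]) (fun hi => absurd (Finset.mem_univ i) hi)] at h2
    change net.utility (y s) ≤ _ at h1
    have h4 : ∑ k, w (y s) k * (s⁻¹ *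
        (Real.log (x.1 i k + s * net.allocDir x i k) - Real.log (x.1 i k))) =
        -(s⁻¹ * ∑ k, w (y s) k * (Real.log (x.1 i k) - Real.log ((y s).1 i k))) := by
      rw [Finset.mul_sum, ← Finset.sum_neg_distrib]
      exact Finset.sum_congr rfl fun k _ => by rw [hηi]; ring
    rw [h4, neg_nonpos]
    exact mul_nonneg (inv_nonneg.2 hs0'.le) (by simp only [w]; linarith)
  have hder : ∀ k, Tendsto (fun s : ℝ => s⁻¹ *
      (Real.log (x.1 i k + s * net.allocDir x i k) - Real.log (x.1 i k))) (𝓝[>] 0)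
      (𝓝 (net.allocDir x i k / x.1 i k)) := by
    intro k
    have h1 : HasDerivAt (fun s : ℝ => x.1 i k + s * net.allocDir x i k)
        (net.allocDir x i k) 0 := by
      simpa using ((hasDerivAt_id (0 : ℝ)).mul_const (net.allocDir x i k)).const_add (x.1 i k)
    have h2 := (h1.log (by simpa using (hx.1 i k).ne')).tendsto_slope_zero_right
    simpa using h2
  have hsum := le_of_tendsto (tendsto_finsetSum Finset.univ fun k _ => (hw k).mul (hder k)) key
  -- The indicator is `allocDir` plus a constant, and the constants drop out because the directions
  -- sum to zero. What remains is a sum of squares, which must therefore vanish.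
  have hval : ∑ k, w x k * (net.allocDir x i k / x.1 i k) =
      net.nodePower x.2 i * ∑ k, net.allocDir x i k ^ 2 := by
    have hd : ∀ k, net.dEta x.1 x.2 i k = net.allocDir x i k +
        (∑ k, net.dEta x.1 x.2 i k) / Fintype.card (net.out i) := fun k => by
      rw [allocDir]; ring
    set c := (∑ k, net.dEta x.1 x.2 i k) / Fintype.card (net.out i)
    have h1 : ∀ k, w x k * (net.allocDir x i k / x.1 i k) =
        net.nodePower x.2 i * net.allocDir x i k ^ 2 +
        (net.nodePower x.2 i * c - net.selfTerm x.1 x.2 i) * net.allocDir x i k := by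
      intro k
      have := (hx.1 i k).ne'
      simp only [w]
      rw [hd k]
      field_simp
      ring
    simp only [h1]
    rw [Finset.sum_add_distrib, ← Finset.mul_sum, ← Finset.mul_sum, sum_allocDir hx, mul_zero,
      add_zero]
  rw [hval] at hsum
  have h0 : ∑ k, net.allocDir x i k ^ 2 ≤ 0 := by
    by_contra! hpos
    linarith [mul_pos (net.nodePower_pos x.2 i) hpos]
  have h1 := Finset.single_le_sum (f := fun k => net.allocDir x i k ^ 2)
    (fun k _ => sq_nonneg _) (Finset.mem_univ j)
  exact pow_eq_zero_iff two_ne_zero |>.1 (le_antisymm (h1.trans h0) (sq_nonneg _))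

theorem stationary_of_stuck (hx : x ∈ net.interiorSet)
    (h : BlockAscent.Stuck net.interiorSet net.utility net.step x) : net.Stationary x :=
  ⟨allocDir_of_stuck hx h, dGamma_of_stuck hx h⟩

/-- The optimal configuration is unique. -/
theorem eq_of_stuck_of_utility_le (hx : x ∈ net.interiorSet) (hy : y ∈ net.interiorSet)
    (h : BlockAscent.Stuck net.interiorSet net.utility net.step x)
    (hle : net.utility x ≤ net.utility y) : y = x := by
  have hxs := stationary_of_stuck hx h
  -- As x is a global maximizer, so is y; hence no step improves y either.
  have hys : net.Stationary y := stationary_of_stuck hy fun b σ _ hD =>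
    (hxs.utility_le_and_alloc_eq hx hD).1.trans hle
  have h1 := (hxs.utility_le_and_alloc_eq hx hy).2 hle
  refine Prod.ext h1 (funext fun i => le_antisymm ?_ ?_)
  · exact hxs.control_le hx hy hys h1 i
  · exact hys.control_le hy hx hxs h1.symm i

end optimality

end CDMANetwork

/-! ### Extended real sums and explicit projections. -/

theorem EReal.coe_finsetSum {ι : Type*} (s : Finset ι) (f : ι → ℝ) :
    ((∑ t ∈ s, f t : ℝ) : EReal) = ∑ t ∈ s, (f t : EReal) := by
  classical
  induction s using Finset.induction_on with
  | empty => simp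
  | insert a s ha ih => rw [Finset.sum_insert ha, Finset.sum_insert ha, EReal.coe_add, ih]

theorem EReal.sum_eq_bot_of_mem {ι : Type*} {s : Finset ι} {f : ι → EReal} {t : ι} (ht : t ∈ s)
    (hf : f t = ⊥) : ∑ t ∈ s, f t = ⊥ := by
  classical
  rw [← Finset.add_sum_erase _ _ ht, hf, EReal.bot_add]

/-- Orthogonal projection on the simplex: a point `y` of it such that `z - y` is a constant
vector. -/
theorem isScaledProjection_one_stdSimplex {ι : Type*} [Fintype ι] [DecidableEq ι] {z y : ι → ℝ}
    (hy : y ∈ stdSimplex ℝ ι) {c : ℝ} (hyz : ∀ j, z j - y j = c) :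
    IsScaledProjection (1 : Matrix ι ι ℝ) (stdSimplex ℝ ι) z y := by
  refine ⟨hy, fun x hx => ?_⟩
  simp only [Matrix.one_mulVec, dotProduct, Pi.sub_apply]
  have h1 : ∀ j, (y j - z j) * (y j - z j) ≤
      (x j - z j) * (x j - z j) + 2 * c * (x j - y j) := fun j => by
    have := hyz j
    have hz : z j = y j + c := by linarith
    rw [hz]
    nlinarith [sq_nonneg (x j - y j)]
  refine (Finset.sum_le_sum fun j _ => h1 j).trans (le_of_eq ?_)
  rw [Finset.sum_add_distrib, ← Finset.mul_sum, Finset.sum_sub_distrib, hx.2, hy.2, sub_self,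
    mul_zero, add_zero]

/-- The projection on `{γ | ∀ i, γ i ≤ 1}` relative to a diagonal matrix is componentwise. -/
theorem isScaledProjection_diagonal_controlSet {ι : Type*} [Fintype ι] [DecidableEq ι]
    {d : ι → ℝ} (hd : ∀ i, 0 ≤ d i) (z : ι → ℝ) :
    IsScaledProjection (Matrix.diagonal d) (CDMANetwork.controlSet ι) z
      (fun i => min 1 (z i)) := by
  refine ⟨fun i => min_le_left _ _, fun x hx => ?_⟩
  simp only [Matrix.mulVec_diagonal, dotProduct, Pi.sub_apply]
  refine Finset.sum_le_sum fun i _ => ?_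
  have h : (min 1 (z i) - z i) ^ 2 ≤ (x i - z i) ^ 2 := by
    have hxi : x i ≤ 1 := hx i
    rcases le_total (z i) 1 with h | h
    · rw [min_eq_right h, sub_self, zero_pow two_ne_zero]
      exact sq_nonneg _
    · rw [min_eq_left h]
      nlinarith
  nlinarith [mul_le_mul_of_nonneg_left h (hd i)]

/-! ### Coercivity, boundary allocations, and the steps as projections. -/

namespace CDMANetwork

variable {N : Type*} [Fintype N] [DecidableEq N] {net : CDMANetwork N}
  {x : net.Alloc × (N → ℝ)}

/-- IN is bounded below by the noise. The two variable terms are nonpositive on the interior set,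
and they tend to -∞ as the share tends to 0 or the power control to -∞. -/
theorem log_SINR_le (hx : x ∈ net.interiorSet) (i : N) (j : net.out i) :
    Real.log (net.SINR x.1 x.2 i j) ≤ Real.log (net.K * net.gain i j * net.peak i / net.noise j) +
      Real.log (x.1 i j) + (x.2 i - 1) * Real.log (net.peak i) := by
  have hg : 0 < net.K * net.gain i j := mul_pos net.K_pos (net.gain_pos i j j.2)
  have hp := net.nodePower_pos x.2 i
  have hpk := one_pos.trans (net.one_lt_peak i)
  rw [SINR, linkPower, Real.log_div (mul_pos hg (mul_pos hp (hx.1 i j))).ne' (IN_pos hx i j).ne',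
    Real.log_mul hg.ne' (mul_pos hp (hx.1 i j)).ne', Real.log_mul hp.ne' (hx.1 i j).ne',
    log_nodePower, Real.log_div (mul_pos hg hpk).ne' (net.noise_pos j).ne',
    Real.log_mul hg.ne' hpk.ne']
  have := Real.log_le_log (net.noise_pos j) (noise_le_IN hx i j)
  linarith

/-- An upper bound of the objective. -/
noncomputable def utilityBound (net : CDMANetwork N) : ℝ :=
  ∑ i, ∑ j : net.out i, net.b i j * Real.log (net.K * net.gain i j * net.peak i / net.noise j)

theorem utility_le_utilityBound_add (hx : x ∈ net.interiorSet) (i : N) (j : net.out i) :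
    net.utility x ≤ net.utilityBound +
      net.b i j * (Real.log (x.1 i j) + (x.2 i - 1) * Real.log (net.peak i)) := by
  have h0 : ∀ m (k : net.out m), net.b m k *
      (Real.log (x.1 m k) + (x.2 m - 1) * Real.log (net.peak m)) ≤ 0 := fun m k =>
    mul_nonpos_of_nonneg_of_nonpos (net.b_pos m k k.2).le (add_nonpos
      (Real.log_nonpos (hx.1 m k).le (le_one_of_mem_interiorSet hx m k))
      (mul_nonpos_of_nonpos_of_nonneg (by linarith [hx.2.2 m]) (net.log_peak_pos m).le))
  have h1 : net.utility x ≤ net.utilityBound + ∑ m, ∑ k : net.out m, net.b m k *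
      (Real.log (x.1 m k) + (x.2 m - 1) * Real.log (net.peak m)) := by
    rw [utility, utilityBound, ← Finset.sum_add_distrib]
    refine Finset.sum_le_sum fun m _ => ?_
    rw [← Finset.sum_add_distrib]
    refine Finset.sum_le_sum fun k _ => ?_
    rw [← mul_add, ← add_assoc]
    exact mul_le_mul_of_nonneg_left (log_SINR_le hx m k) (net.b_pos m k k.2).le
  refine h1.trans (add_le_add_right ?_ _)
  rw [← Finset.add_sum_erase _ _ (Finset.mem_univ i),
    ← Finset.add_sum_erase _ _ (Finset.mem_univ j)]
  have h2 := Finset.sum_nonpos fun k (_ : k ∈ Finset.univ.erase j) => h0 i k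
  have h3 := Finset.sum_nonpos fun m (_ : m ∈ Finset.univ.erase i) =>
    Finset.sum_nonpos fun k (_ : k ∈ Finset.univ) => h0 m k
  linarith

theorem bddAbove_utility (net : CDMANetwork N) : BddAbove (net.utility '' net.interiorSet) := by
  rcases isEmpty_or_nonempty N with hN | ⟨⟨i⟩⟩
  · exact ⟨0, by rintro _ ⟨x, -, rfl⟩; simp [utility]⟩
  · refine ⟨net.utilityBound, ?_⟩
    rintro _ ⟨x, hx, rfl⟩
    obtain ⟨j⟩ := nonempty_out_of_mem_interiorSet hx i
    refine (utility_le_utilityBound_add hx i j).trans (add_le_of_nonpos_right ?_)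
    exact mul_nonpos_of_nonneg_of_nonpos (net.b_pos i j j.2).le (add_nonpos
      (Real.log_nonpos (hx.1 i j).le (le_one_of_mem_interiorSet hx i j))
      (mul_nonpos_of_nonpos_of_nonneg (by linarith [hx.2.2 i]) (net.log_peak_pos i).le))

/-- Superlevel sets of the objective are compact within the interior configurations. -/
theorem exists_isCompact_superlevel (net : CDMANetwork N) (c : ℝ) :
    ∃ K ⊆ net.interiorSet, IsCompact K ∧
      ∀ x ∈ net.interiorSet, c ≤ net.utility x → x ∈ K := by
  set d := c - net.utilityBound with hd
  let lo : net.Alloc := fun i j => Real.exp (d / net.b i j)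
  -- Any single link gives a lower bound for γ_i; the sum of absolute values covers each of them
  -- without choosing one.
  let lo' : N → ℝ := fun i => 1 - ∑ j : net.out i, |d / net.b i j / Real.log (net.peak i)|
  let K : Set (net.Alloc × (N → ℝ)) :=
    (Set.univ.pi fun i => Set.univ.pi fun j => Set.Icc (lo i j) 1) ×ˢ
      (Set.univ.pi fun i => Set.Icc (lo' i) 1) ∩ {x | ∀ i, ∑ j, x.1 i j = 1}
  refine ⟨K, ?_, ?_, ?_⟩
  · rintro x ⟨⟨h1, h2⟩, h3⟩
    refine ⟨fun i j => (Real.exp_pos _).trans_le (h1 i trivial j trivial).1, h3,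
      fun i => (h2 i trivial).2⟩
  · refine IsCompact.inter_right (IsCompact.prod ?_ ?_) ?_
    · exact isCompact_univ_pi fun i => isCompact_univ_pi fun j => isCompact_Icc
    · exact isCompact_univ_pi fun i => isCompact_Icc
    · have : {x : net.Alloc × (N → ℝ) | ∀ i, ∑ j, x.1 i j = 1} =
          ⋂ i, {x | ∑ j, x.1 i j = 1} := by ext; simp
      rw [this]
      exact isClosed_iInter fun i => isClosed_eq
        (continuous_finsetSum _ fun j _ => net.continuous_alloc i j) continuous_const
  · intro x hx hc
    have hkey : ∀ i (j : net.out i), d / net.b i j ≤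
        Real.log (x.1 i j) + (x.2 i - 1) * Real.log (net.peak i) := by
      intro i j
      rw [div_le_iff₀ (net.b_pos i j j.2)]
      linarith [utility_le_utilityBound_add hx i j]
    refine ⟨⟨fun i _ j _ => ⟨?_, le_one_of_mem_interiorSet hx i j⟩,
      fun i _ => ⟨?_, hx.2.2 i⟩⟩, hx.2.1⟩
    · rw [← Real.le_log_iff_exp_le (hx.1 i j)]
      have := mul_nonpos_of_nonpos_of_nonneg (sub_nonpos.2 (hx.2.2 i)) (net.log_peak_pos i).le
      linarith [hkey i j]
    · obtain ⟨j⟩ := nonempty_out_of_mem_interiorSet hx i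
      have h1 : d / net.b i j / Real.log (net.peak i) ≤ x.2 i - 1 := by
        rw [div_le_iff₀ (net.log_peak_pos i)]
        linarith [hkey i j,
          Real.log_nonpos (hx.1 i j).le (le_one_of_mem_interiorSet hx i j)]
      have h2 := Finset.single_le_sum
        (f := fun j : net.out i => |d / net.b i j / Real.log (net.peak i)|)
        (fun j _ => abs_nonneg _) (Finset.mem_univ j)
      have h3 := neg_abs_le (d / net.b i j / Real.log (net.peak i))
      simp only [lo']
      linarith

theorem objective_eq_utility (hx : x ∈ net.interiorSet) :
    net.objective x.1 x.2 = (net.utility x : EReal) := by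
  rw [objective, utility, EReal.coe_finsetSum]
  refine Finset.sum_congr rfl fun i _ => ?_
  rw [EReal.coe_finsetSum]
  refine Finset.sum_congr rfl fun j _ => ?_
  rw [ENNReal.log_ofReal_of_pos (SINR_pos hx i j), EReal.coe_mul]

theorem objective_eq_bot {η : net.Alloc} {i : N} {j : net.out i} (h : η i j = 0) (γ : N → ℝ) :
    net.objective η γ = ⊥ := by
  refine EReal.sum_eq_bot_of_mem (Finset.mem_univ i)
    (EReal.sum_eq_bot_of_mem (Finset.mem_univ j) ?_)
  rw [SINR, linkPower, h, mul_zero, mul_zero, zero_div, ENNReal.ofReal_zero, ENNReal.log_zero,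
    EReal.coe_mul_bot_of_pos (net.b_pos i j j.2)]

/-- Competitors with a vanishing share have value -∞; all others are interior, where the real
comparison applies. -/
theorem Stationary.solvesTOPC (hx : x ∈ net.interiorSet) (h : net.Stationary x) :
    net.SolvesTOPC x.1 x.2 := by
  refine ⟨fun i => ⟨fun j => (hx.1 i j).le, hx.2.1 i⟩, hx.2.2, fun η' γ' hη' hγ' => ?_⟩
  by_cases hpos : ∀ i j, 0 < η' i j
  · have hy : (η', γ') ∈ net.interiorSet := ⟨hpos, fun i => (hη' i).2, hγ'⟩
    have h1 := objective_eq_utility hy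
    simp only at h1
    rw [h1, objective_eq_utility hx, EReal.coe_le_coe_iff]
    exact (h.utility_le_and_alloc_eq hx hy).1
  · push Not at hpos
    obtain ⟨i, j, hij⟩ := hpos
    rw [objective_eq_bot (le_antisymm hij ((hη' i).1 j))]
    exact bot_le

/-- The unprojected point differs from v by β times the mean indicator in every coordinate, which is
the optimality condition for the simplex when v is positive. -/
theorem isPA_step (hx : x ∈ net.interiorSet) (i : N) {β : ℝ} {v : net.out i → ℝ}
    (hv : ∀ j, v j = x.1 i j + β * net.allocDir x i j) (hpos : ∀ j, 0 < v j) :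
    net.IsPA x.1 x.2 i 1 β v := by
  refine isScaledProjection_one_stdSimplex ⟨fun j => (hpos j).le, ?_⟩
    (c := β * ((∑ k, net.dEta x.1 x.2 i k) / Fintype.card (net.out i))) fun j => ?_
  · simp only [hv]
    rw [Finset.sum_add_distrib, ← Finset.mul_sum, sum_allocDir hx, hx.2.1, mul_zero, add_zero]
  · rw [hv, inv_one, Matrix.one_mulVec, allocDir, Pi.add_apply, Pi.smul_apply, smul_eq_mul]
    ring

/-- The common stepsize is 1, and the inverse of the diagonal scaling matrix supplies the separate
stepsizes. -/
theorem isPC_step (net : CDMANetwork N) (x : net.Alloc × (N → ℝ)) {s : N → ℝ}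
    (hs : ∀ i, 0 < s i) :
    net.IsPC x.1 x.2 (Matrix.diagonal fun i => (s i)⁻¹) 1
      (fun i => min 1 (x.2 i + s i * net.dGamma x.1 x.2 i)) := by
  have hinv : (Matrix.diagonal fun i => (s i)⁻¹)⁻¹ = Matrix.diagonal s := by
    refine Matrix.inv_eq_right_inv ?_
    rw [Matrix.diagonal_mul_diagonal, ← Matrix.diagonal_one]
    congr 1
    funext i
    exact inv_mul_cancel₀ (hs i).ne'
  have h := isScaledProjection_diagonal_controlSet (fun i => (inv_pos.2 (hs i)).le)
    (x.2 + (1 : ℝ) • ((Matrix.diagonal fun i => (s i)⁻¹)⁻¹ *ᵥ net.dGamma x.1 x.2))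
  rw [IsPC]
  convert h using 2 with i
  rw [hinv, one_smul, Pi.add_apply, Matrix.mulVec_diagonal]

end CDMANetwork

theorem validAllocScaling_one {ι : Type*} [Fintype ι] [DecidableEq ι] :
    ValidAllocScaling (1 : Matrix ι ι ℝ) := by
  refine ⟨Matrix.isSymm_one, fun v hv _ => ?_, by simp, Matrix.isDiag_one⟩
  rw [Matrix.one_mulVec]
  exact lt_of_le_of_ne (Finset.sum_nonneg fun j _ => mul_self_nonneg _)
    fun h => hv (dotProduct_self_eq_zero.1 h.symm)

/-! ### Assembly: two blocks per node, allocation and power. -/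

theorem theorem3 {N : Type*} [Fintype N] [DecidableEq N] (net : CDMANetwork N)
    (η₀ : net.Alloc) (γ₀ : N → ℝ)
    (hη₀ : net.FeasibleAlloc η₀) (hη₀pos : ∀ i j, 0 < η₀ i j)
    (hγ₀ : γ₀ ∈ CDMANetwork.controlSet N)
    (runPA runPC : ℕ → Set N)
    (hPA : ∀ i, ∃ᶠ k in atTop, i ∈ runPA k) (hPC : ∀ i, ∃ᶠ k in atTop, i ∈ runPC k) :
    ∃ (Q : ℕ → (i : N) → Matrix (net.out i) (net.out i) ℝ) (β : ℕ → N → ℝ)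
      (V : ℕ → Matrix N N ℝ) (ξ : ℕ → ℝ),
      (∀ k i, ValidAllocScaling (Q k i)) ∧ (∀ k, ValidControlScaling (V k)) ∧
      (∀ k i, 0 < β k i) ∧ (∀ k, 0 < ξ k) ∧
      ∃ (η : ℕ → net.Alloc) (γ : ℕ → N → ℝ),
        η 0 = η₀ ∧ γ 0 = γ₀ ∧ net.Generated runPA runPC Q β V ξ η γ ∧
        ∃ (ηs : net.Alloc) (γs : N → ℝ),
          (∀ i, Tendsto (fun k => η k i) atTop (𝓝 (ηs i))) ∧
          Tendsto γ atTop (𝓝 γs) ∧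
          net.SolvesTOPC ηs γs := by
  have hx₀ : (η₀, γ₀) ∈ net.interiorSet := ⟨hη₀pos, fun i => (hη₀ i).2, hγ₀⟩
  let run : ℕ → Set (N ⊕ N) := fun k => {b | Sum.elim (· ∈ runPA k) (· ∈ runPC k) b}
  obtain ⟨p, x, hp, hx0, hxD, hstep, xs, hxsD, hxs, hlim⟩ :=
    BlockAscent.exists_stepsizes_tendsto (run := run) (F := net.utility) (T := net.step)
      (by rintro (i | i); exacts [hPA i, hPC i])
      (fun x hx => CDMANetwork.continuousAt_utility hx)
      (fun x hx p => CDMANetwork.continuousAt_step hx p)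
      (fun x hx => CDMANetwork.step_zero hx)
      (fun x hx p hp => CDMANetwork.eventually_step_mem hx hp)
      net.exists_isCompact_superlevel net.bddAbove_utility
      (fun x hx h p hp => (CDMANetwork.stationary_of_stuck hx h).step_eq hx hp)
      (fun x hx y hy h hle => CDMANetwork.eq_of_stuck_of_utility_le hx hy h hle) hx₀
  have hmask : ∀ k b, (b ∈ run k → BlockAscent.mask (run k) (p k) b = p k b) ∧
      (b ∉ run k → BlockAscent.mask (run k) (p k) b = 0) := fun k b =>
    ⟨fun h => Set.indicator_of_mem h _, fun h => Set.indicator_of_notMem h _⟩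
  refine ⟨fun _ _ => 1, fun k i => p k (Sum.inl i),
    fun k => Matrix.diagonal fun i => (p k (Sum.inr i))⁻¹, fun _ => 1,
    fun _ _ => validAllocScaling_one,
    fun k => ⟨Matrix.PosDef.diagonal fun i => inv_pos.2 (hp k _), Matrix.isDiag_diagonal _⟩,
    fun k i => hp k _, fun _ => one_pos, fun k => (x k).1, fun k => (x k).2, congrArg Prod.fst hx0,
    congrArg Prod.snd hx0, ⟨fun k => (hxD k).1, fun k i hi => ?_, fun k i hi => ?_, fun k => ?_⟩,
    xs.1, xs.2, fun i => ?_, ?_, (CDMANetwork.stationary_of_stuck hxsD hxs).solvesTOPC hxsD⟩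
  · refine CDMANetwork.isPA_step (hxD k) i (fun j => ?_) ((hxD (k + 1)).1 i)
    rw [hstep k, CDMANetwork.step_fst_apply, (hmask k (Sum.inl i)).1 hi]
  · funext j
    rw [hstep k, CDMANetwork.step_fst_apply, (hmask k (Sum.inl i)).2 hi, zero_mul, add_zero]
  · refine ⟨_, CDMANetwork.isPC_step net (x k) fun i => hp k (Sum.inr i), fun i hi => ?_,
      fun i hi => ?_⟩
    · rw [hstep k, CDMANetwork.step_snd_apply, (hmask k (Sum.inr i)).1 hi]
    · rw [hstep k, CDMANetwork.step_snd_apply, (hmask k (Sum.inr i)).2 hi, zero_mul, add_zero,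
        min_eq_right ((hxD k).2.2 i)]
  · exact ((continuous_apply i).comp continuous_fst).continuousAt.tendsto.comp hlim
  · exact continuous_snd.continuousAt.tendsto.comp hlim
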